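/- Let $\Gamma=\{(A(1),C(1)),\dots,(A(l),C(l))\}$ be a finite set of modes, $A(j)\in\mathbb R^{n\times n}$, $C(j)\in\mathbb R^{m\times n}$, let $(A_k,C_k)_{k\ge 0}$ be a random sequence in $\Gamma$, and consider $$x_{k+1}=A_kx_k+w_k,\qquad y_k=C_kx_k+D^ad_k^a+v_k,$$ with $x_0\sim\mathcal N(\hat x_{0|-1},P_{0|-1})$, i.i.d. $w_k\sim\mathcal N(0,Q)$ with $Q\succeq 0$ and i.i.d. $v_k\sim\mathcal N(0,R)$ with $R\succ0$, where $x_0$, $\{w_k\}$, $\{v_k\}$ and the mode sequence are mutually independent. Here $d^a_k\in\mathbb R^{q}$ is the attack on a fixed ordered set of distinct sensors $\{s_1,\dots,s_q\}$, and $D^a\in\mathbb R^{m\times q}$ has entry $(a,b)$ equal to $1$ if $a=s_b$ and $0$ otherwise. The attacker does not know the mode sequence: $\{d_k^a\}$ is a random sequence independent of $\{(A_k,C_k)\}$. Assume the following design of the modes: (1) $A(i)$ and $A(j)$ have no common complex eigenvalue for $i\ne j$; (2) there is $\kappa\ge 2n$ such that the mode is constant on each block of times $i\kappa\le k<(i+1)\kappa$,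 $i\ge0$; (3) for every sequence $l_k\in\{1,\dots,l\}$ and every strictly increasing sequence $\varrho_k$ of times, $\Pr\big((A_{\varrho_k},C_{\varrho_k})=(A(l_k),C(l_k))\ \forall k\big)=0$; (4) every pair $(A(i),C(i))$ is observable; (5) no $A(i)$ has the eigenvalue $0$. Assume moreover that for each sensor $s$ the null space of the matrix $\mathcal O^s_{n,j}$ with rows $C^s(j)A(j)^{i}$, $0\le i<n$ ($C^s(j)$ the $s$th row of $C(j)$), does not depend on the mode $j$. For each $s$ let $\mathcal T_s=[\mathcal T_s^{uo}\ \mathcal T_s^{o}]$ be any invertible matrix such that the columns of $\mathcal T_s^{uo}$ are a basis of this null space, let $V_s$ be the block of the last rows of $\mathcal T_s^{-1}$ (as many as $\mathcal T_s^o$ has columns), and put $A_{k,s}=V_sA_k\mathcal T_s^o$, $C_{k,s}=C_k^s\mathcal T_s^o$, $Q_{s_1,s_2}=V_{s_1}QV_{s_2}^T$. The sensor-wise Kalman filters are $$\hat\zeta_{k+1|k,s}=A_{k,s}\hat\zeta_{k|k,s},\qquad \hat\zeta_{k|k,s}=(I-K_{k,s}C_{k,s})\hat\zeta_{k|k-1,s}+K_{k,s}y_k^s,$$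 $$K_{k,s}=P^{s,s}_{k|k-1}C_{k,s}^T(C_{k,s}P^{s,s}_{k|k-1}C_{k,s}^T+R_{s,s})^{-1},\qquad P^{s_1,s_2}_{k+1|k}=A_{k,s_1}P^{s_1,s_2}_{k|k}A_{k,s_2}^T+Q_{s_1,s_2},$$ $$P^{s_1,s_2}_{k|k}=(I-K_{k,s_1}C_{k,s_1})P^{s_1,s_2}_{k|k-1}(I-K_{k,s_2}C_{k,s_2})^T+K_{k,s_1}R_{s_1,s_2}K_{k,s_2}^T,$$ with $\hat\zeta_{0|-1,s}=V_s\hat x_{0|-1}$ and $P_{0|-1}^{s_1,s_2}=V_{s_1}P_{0|-1}V_{s_2}^T$, and the normalized residues are $z_{k,s}=(C_{k,s}P^{s,s}_{k|k-1}C_{k,s}^T+R_{s,s})^{-1/2}(y_k^s-C_{k,s}\hat\zeta_{k|k-1,s})$. Let $\sigma>0$, let $\alpha_{k,s}\sim\mathcal N(0,\sigma I)$ be independent over $k$ and $s$ and independent of $x_0$, $\{w_k\}$, $\{v_k\}$ and the modes, let $\hat{\mathbf y}_k$ be the stacked vector of $\mathcal T_s^o\hat\zeta_{k|k,s}+\alpha_{k,s}$,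 $s=1,\dots,m$, let $W$ be the matrix whose $s$th block row is $[0\cdots-\mathcal T_s^{uo}\cdots0\ \ I]$ (with $-\mathcal T_s^{uo}$ in the $s$th block), and let $\Upsilon_k$ have the blocks $\mathcal T_i^oP^{i,j}_{k|k}\mathcal T_j^{oT}+\delta_{ij}\sigma I$. The fused estimate $\hat x_k^*$ of $x_k$ consists of the last $n$ entries of $(W^T\Upsilon_k^{-1}W)^{-1}W^T\Upsilon_k^{-1}\hat{\mathbf y}_k$, and $e_k^*=x_k-\hat x_k^*$. Let $\Delta e_k^*$ and $\Delta z_{k,s}$ denote the biases on $e_k^*$ and $z_{k,s}$ due to the attack, i.e. the value under the attack minus the value for $d^a\equiv0$ with the same realization of modes, initial state and noises. Then, with probability 1, $$\limsup_{k\to\infty}\|\Delta e_k^*\|=\infty\ \Longrightarrow\ \limsup_{k\to\infty}|\Delta z_{k,i}|=\infty\ \text{ for some } i\in\{1,\dots,m\}.$$ -/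

import Mathlib

open MeasureTheory ProbabilityTheory Filter
open scoped Matrix ENNReal

noncomputable section

/-- The data of the switched stochastic plant with `n` states, `m` scalar sensors and `l` modes:
the finite set of modes `(A j, C j)`, the process noise covariance `Q`, the sensor noise covariance
`R`, and the mean `xhat0` and covariance `P0` of the initial state. -/
structure HybridSystem (n m l : ℕ) where
  /-- state matrix of each mode -/
  A : Fin l → Matrix (Fin n) (Fin n) ℝ
  /-- output matrix of each mode; its row `s` belongs to sensor `s` -/
  C : Fin l → Matrix (Fin m) (Fin n) ℝ
  /-- process noise covariance -/
  Q : Matrix (Fin n) (Fin n) ℝ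
  /-- sensor noise covariance -/
  R : Matrix (Fin m) (Fin m) ℝ
  /-- mean of the initial state -/
  xhat0 : EuclideanSpace ℝ (Fin n)
  /-- covariance of the initial state -/
  P0 : Matrix (Fin n) (Fin n) ℝ
  Q_posSemidef : Q.PosSemidef
  R_posDef : R.PosDef
  P0_posSemidef : P0.PosSemidef

/-- A change of coordinates `[Tuo To]` of the state space, with inverse `[Vuo ; Vo]`. It writes
`x = Tuo ζuo + To ζ` with `ζuo = Vuo x` and `ζ = Vo x`. -/
structure SensorTransform (n : ℕ) where
  /-- number of unobservable coordinates -/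
  u : ℕ
  /-- number of observable coordinates -/
  r : ℕ
  /-- columns for the unobservable coordinates -/
  Tuo : Matrix (Fin n) (Fin u) ℝ
  /-- columns for the observable coordinates -/
  To : Matrix (Fin n) (Fin r) ℝ
  /-- upper rows of the inverse -/
  Vuo : Matrix (Fin u) (Fin n) ℝ
  /-- lower rows of the inverse -/
  Vo : Matrix (Fin r) (Fin n) ℝ
  mul_inv : Matrix.fromCols Tuo To * Matrix.fromRows Vuo Vo = 1
  inv_mul : Matrix.fromRows Vuo Vo * Matrix.fromCols Tuo To = 1

/-- The attack matrix of the ordered set of sensors `L`: entry `(a, b)` is `1` if `a` is the `b`-th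
attacked sensor, and `0` otherwise. -/
def attackMatrix {m q : ℕ} (L : Fin q ↪ Fin m) : Matrix (Fin m) (Fin q) ℝ :=
  Matrix.of fun a b => if a = L b then 1 else 0

/-- A pair `(A, C)` is observable: the Kalman observability matrix with the blocks `C A ^ k`,
`k < n`, has trivial null space. -/
def IsObservablePair {n m : ℕ} (A : Matrix (Fin n) (Fin n) ℝ) (C : Matrix (Fin m) (Fin n) ℝ) :
    Prop :=
  ∀ x : Fin n → ℝ, (∀ k < n, (C * A ^ k) *ᵥ x = 0) → x = 0

/-- The set of (complex) eigenvalues of a real square matrix. -/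
def eigenvalueSet {n : ℕ} (A : Matrix (Fin n) (Fin n) ℝ) : Set ℂ :=
  spectrum ℂ (A.map (algebraMap ℝ ℂ))

namespace HybridSystem

variable {n m l : ℕ} (G : HybridSystem n m l)

/-- The observability matrix of sensor `s` in mode `j` over `t` steps: row `i` is `C^s(j) A(j)^i`. -/
def obsMatrix (s : Fin m) (t : ℕ) (j : Fin l) : Matrix (Fin t) (Fin n) ℝ :=
  Matrix.of fun i => (G.C j) s ᵥ* (G.A j) ^ (i : ℕ)

/-- Null space of the observability matrix of sensor `s` in mode `j` over `n` steps. -/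
def unobservable (s : Fin m) (j : Fin l) : Submodule ℝ (Fin n → ℝ) :=
  LinearMap.ker (G.obsMatrix s n j).mulVecLin

/-! ### Plant -/

/-- `x_{k+1} = A_k x_k + w_k` along the mode sequence `μ`. -/
def state (μ : ℕ → Fin l) (x0 : Fin n → ℝ) (w : ℕ → Fin n → ℝ) : ℕ → Fin n → ℝ
  | 0 => x0
  | k + 1 => G.A (μ k) *ᵥ state μ x0 w k + w k

/-- `y_k = C_k x_k + a_k + v_k`, where `a_k` is the bias that the attacker adds. -/
def measurement (μ : ℕ → Fin l) (x0 : Fin n → ℝ) (w : ℕ → Fin n → ℝ) (v : ℕ → Fin m → ℝ)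
    (a : ℕ → Fin m → ℝ) (k : ℕ) : Fin m → ℝ :=
  G.C (μ k) *ᵥ G.state μ x0 w k + a k + v k

/-! ### Kalman filters of the individual sensors -/

variable (T : Fin m → SensorTransform n)

/-- State matrix of the observable part for sensor `s` in mode `j`. -/
def localA (s : Fin m) (j : Fin l) : Matrix (Fin (T s).r) (Fin (T s).r) ℝ :=
  (T s).Vo * G.A j * (T s).To

/-- Output row of the observable part for sensor `s` in mode `j`. -/
def localC (s : Fin m) (j : Fin l) : Fin (T s).r → ℝ :=
  (G.C j) s ᵥ* (T s).To

/-- Innovation variance `C P Cᵀ + R_{s,s}` for sensor `s` in mode `j`, with prior covariance `P`. -/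
def innovVar (s : Fin m) (j : Fin l) (P : Matrix (Fin (T s).r) (Fin (T s).r) ℝ) : ℝ :=
  G.localC T s j ⬝ᵥ (P *ᵥ G.localC T s j) + G.R s s

/-- Kalman gain `P Cᵀ (C P Cᵀ + R_{s,s})⁻¹` for sensor `s` in mode `j`. -/
def gain (s : Fin m) (j : Fin l) (P : Matrix (Fin (T s).r) (Fin (T s).r) ℝ) : Fin (T s).r → ℝ :=
  (G.innovVar T s j P)⁻¹ • (P *ᵥ G.localC T s j)

/-- The closed-loop factor `I - K C` for sensor `s` in mode `j`. -/
def updFactor (s : Fin m) (j : Fin l) (P : Matrix (Fin (T s).r) (Fin (T s).r) ℝ) :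
    Matrix (Fin (T s).r) (Fin (T s).r) ℝ :=
  1 - Matrix.vecMulVec (G.gain T s j P) (G.localC T s j)

/-- Measurement update of the family of all (cross-)covariances in mode `j`. -/
def covUpdate (j : Fin l) (P : ∀ s₁ s₂ : Fin m, Matrix (Fin (T s₁).r) (Fin (T s₂).r) ℝ)
    (s₁ s₂ : Fin m) : Matrix (Fin (T s₁).r) (Fin (T s₂).r) ℝ :=
  G.updFactor T s₁ j (P s₁ s₁) * P s₁ s₂ * (G.updFactor T s₂ j (P s₂ s₂))ᵀ
    + G.R s₁ s₂ • Matrix.vecMulVec (G.gain T s₁ j (P s₁ s₁)) (G.gain T s₂ j (P s₂ s₂))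

/-- The a priori error (cross-)covariances `P_{k|k-1}^{s₁,s₂}`. -/
def priorCov (μ : ℕ → Fin l) :
    ℕ → ∀ s₁ s₂ : Fin m, Matrix (Fin (T s₁).r) (Fin (T s₂).r) ℝ
  | 0 => fun s₁ s₂ => (T s₁).Vo * G.P0 * (T s₂).Voᵀ
  | k + 1 => fun s₁ s₂ =>
      G.localA T s₁ (μ k) * G.covUpdate T (μ k) (priorCov μ k) s₁ s₂ * (G.localA T s₂ (μ k))ᵀ
        + (T s₁).Vo * G.Q * (T s₂).Voᵀ

/-- The a posteriori error (cross-)covariances `P_{k|k}^{s₁,s₂}`. -/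
def postCov (μ : ℕ → Fin l) (k : ℕ) (s₁ s₂ : Fin m) :
    Matrix (Fin (T s₁).r) (Fin (T s₂).r) ℝ :=
  G.covUpdate T (μ k) (G.priorCov T μ k) s₁ s₂

/-- Measurement update `(I - K C) ζ + K η` of the local estimate of sensor `s` at time `k`, for the
a priori estimate `ζ` and the scalar measurement `η`. -/
def estUpdate (μ : ℕ → Fin l) (k : ℕ) (s : Fin m) (ζ : Fin (T s).r → ℝ) (η : ℝ) :
    Fin (T s).r → ℝ :=
  G.updFactor T s (μ k) (G.priorCov T μ k s s) *ᵥ ζ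
    + η • G.gain T s (μ k) (G.priorCov T μ k s s)

/-- The a priori estimates `ζ̂_{k|k-1,s}` from the measurements `y`. -/
def priorEst (μ : ℕ → Fin l) (y : ℕ → Fin m → ℝ) : ℕ → ∀ s : Fin m, Fin (T s).r → ℝ
  | 0 => fun s => (T s).Vo *ᵥ G.xhat0.ofLp
  | k + 1 => fun s =>
      G.localA T s (μ k) *ᵥ G.estUpdate T μ k s (priorEst μ y k s) (y k s)

/-- The a posteriori estimates `ζ̂_{k|k,s}`. -/
def postEst (μ : ℕ → Fin l) (y : ℕ → Fin m → ℝ) (k : ℕ) (s : Fin m) : Fin (T s).r → ℝ :=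
  G.estUpdate T μ k s (G.priorEst T μ y k s) (y k s)

/-- The normalized residue `z_{k,s}` of sensor `s`. -/
def residue (μ : ℕ → Fin l) (y : ℕ → Fin m → ℝ) (k : ℕ) (s : Fin m) : ℝ :=
  (y k s - G.localC T s (μ k) ⬝ᵥ G.priorEst T μ y k s)
    / Real.sqrt (G.innovVar T s (μ k) (G.priorCov T μ k s s))

/-! ### Fusion -/

/-- The regressor with block row `s` equal to `[0 ⋯ -Tuo_s ⋯ 0  I]`. -/
def fusionW : Matrix (Fin m × Fin n) ((Σ s : Fin m, Fin (T s).u) ⊕ Fin n) ℝ :=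
  Matrix.of fun p c =>
    match c with
    | Sum.inl b => if p.1 = b.1 then -(T b.1).Tuo p.2 b.2 else 0
    | Sum.inr i => if p.2 = i then 1 else 0

/-- The covariance with blocks `To_i P_{k|k}^{i,j} To_jᵀ + δ_{ij} σ I`. -/
def fusionCov (σ : ℝ) (μ : ℕ → Fin l) (k : ℕ) : Matrix (Fin m × Fin n) (Fin m × Fin n) ℝ :=
  Matrix.of fun p p' =>
    ((T p.1).To * G.postCov T μ k p.1 p'.1 * (T p'.1).Toᵀ) p.2 p'.2
      + if p = p' then σ else 0

/-- The stacked vector with blocks `To_s ζ̂_{k|k,s} + α_{k,s}`. -/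
def fusionObs (μ : ℕ → Fin l) (y : ℕ → Fin m → ℝ) (α : ℕ → Fin m → Fin n → ℝ) (k : ℕ) :
    Fin m × Fin n → ℝ :=
  fun p => ((T p.1).To *ᵥ G.postEst T μ y k p.1) p.2 + α k p.1 p.2

/-- The fused estimate of `x_k`: the last `n` entries of `(Wᵀ Υ⁻¹ W)⁻¹ Wᵀ Υ⁻¹ ŷ_k`. -/
def fusedEst (σ : ℝ) (μ : ℕ → Fin l) (y : ℕ → Fin m → ℝ) (α : ℕ → Fin m → Fin n → ℝ) (k : ℕ) :
    Fin n → ℝ :=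
  fun i =>
    ((((fusionW T)ᵀ * (G.fusionCov T σ μ k)⁻¹ * fusionW T)⁻¹
        * (fusionW T)ᵀ * (G.fusionCov T σ μ k)⁻¹) *ᵥ G.fusionObs T μ y α k) (Sum.inr i)

/-- The error `x_k - x̂_k^*` of the fused estimate when the attacker adds the biases `a`. -/
def fusedError (σ : ℝ) (μ : ℕ → Fin l) (x0 : Fin n → ℝ) (w : ℕ → Fin n → ℝ) (v : ℕ → Fin m → ℝ)
    (α : ℕ → Fin m → Fin n → ℝ) (a : ℕ → Fin m → ℝ) (k : ℕ) : Fin n → ℝ :=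
  G.state μ x0 w k - G.fusedEst T σ μ (G.measurement μ x0 w v a) α k

/-- The bias on the fused estimation error due to the attack: its value under the attack minus its
value without attack, for the same realization of everything else. -/
def fusedErrorBias (σ : ℝ) (μ : ℕ → Fin l) (x0 : Fin n → ℝ) (w : ℕ → Fin n → ℝ)
    (v : ℕ → Fin m → ℝ) (α : ℕ → Fin m → Fin n → ℝ) (a : ℕ → Fin m → ℝ) (k : ℕ) :
    EuclideanSpace ℝ (Fin n) :=
  WithLp.toLp 2 (G.fusedError T σ μ x0 w v α a k - G.fusedError T σ μ x0 w v α 0 k)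

/-- The bias on the normalized residue of sensor `s` due to the attack. -/
def residueBias (μ : ℕ → Fin l) (x0 : Fin n → ℝ) (w : ℕ → Fin n → ℝ) (v : ℕ → Fin m → ℝ)
    (a : ℕ → Fin m → ℝ) (k : ℕ) (s : Fin m) : ℝ :=
  G.residue T μ (G.measurement μ x0 w v a) k s - G.residue T μ (G.measurement μ x0 w v 0) k s

/-! ### Standing assumptions -/

variable {Ω : Type*} [MeasurableSpace Ω]

/-- The design recommendations for the mode set and the random mode sequence `mode`, which may be
redrawn every `κ` steps. -/
structure DesignRecommendations (Pr : Measure Ω) (mode : ℕ → Ω → Fin l) (κ : ℕ) : Prop where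
  disjoint_eigenvalues : ∀ i j : Fin l, i ≠ j →
    Disjoint (eigenvalueSet (G.A i)) (eigenvalueSet (G.A j))
  two_mul_le : 2 * n ≤ κ
  mode_const : ∀ k ω, mode k ω = mode (κ * (k / κ)) ω
  unguessable : ∀ (g : ℕ → Fin l) (ρ : ℕ → ℕ), StrictMono ρ →
    Pr {ω | ∀ k, (G.A (mode (ρ k) ω), G.C (mode (ρ k) ω)) = (G.A (g k), G.C (g k))} = 0
  observable : ∀ i, IsObservablePair (G.A i) (G.C i)
  zero_notMem : ∀ i, (0 : ℂ) ∉ eigenvalueSet (G.A i)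

/-- The stochastic model: Gaussian initial state `x0`, process noise `w`, sensor noise `v` and
artificial noise `α` of variance `σ`; the noises are independent over time, the artificial noises
also over the sensors, and `x0`, `w`, `v`, `α` and the mode sequence are mutually independent. -/
structure NoiseModel (Pr : Measure Ω) (σ : ℝ) (mode : ℕ → Ω → Fin l)
    (x0 : Ω → EuclideanSpace ℝ (Fin n)) (w : ℕ → Ω → EuclideanSpace ℝ (Fin n))
    (v : ℕ → Ω → EuclideanSpace ℝ (Fin m)) (α : ℕ → Fin m → Ω → EuclideanSpace ℝ (Fin n)) :
    Prop where
  law_x0 : HasLaw x0 (multivariateGaussian G.xhat0 G.P0) Pr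
  law_w : ∀ k, HasLaw (w k) (multivariateGaussian 0 G.Q) Pr
  law_v : ∀ k, HasLaw (v k) (multivariateGaussian 0 G.R) Pr
  law_α : ∀ k s, HasLaw (α k s) (multivariateGaussian 0 (σ • (1 : Matrix (Fin n) (Fin n) ℝ))) Pr
  iIndep_w : iIndepFun w Pr
  iIndep_v : iIndepFun v Pr
  iIndep_α : iIndepFun (fun p : ℕ × Fin m => α p.1 p.2) Pr
  indep_x0 : IndepFun x0 (fun ω => ((fun k => w k ω), (fun k => v k ω), (fun k s => α k s ω),
    (fun k => mode k ω))) Pr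
  indep_w : IndepFun (fun ω k => w k ω) (fun ω => ((fun k => v k ω), (fun k s => α k s ω),
    (fun k => mode k ω))) Pr
  indep_v : IndepFun (fun ω k => v k ω) (fun ω => ((fun k s => α k s ω), (fun k => mode k ω))) Pr
  indep_α : IndepFun (fun ω k s => α k s ω) (fun ω k => mode k ω) Pr

end HybridSystem

end

noncomputable section

/-! ### Observability -/

namespace Matrix

open Polynomial

variable {ι : Type*} [Fintype ι] [DecidableEq ι]

/-! By contraposition: almost surely, if all residue biases are bounded, then so is the bias of the
fused error. Along a mode path that is constant on blocks of length `κ`, the sensor covariances are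
bounded: the Kalman gain is optimal, so every dual control gives an upper bound, and observability
yields a control that cancels the initial covariance within one block
(`priorCov_quadratic_bounded`). Hence bounded residue biases mean bounded innovation biases and
corrections, and on each block the attack on a sensor stays within a bounded distance of the outputs
that the active mode can produce (`measDiff_sub_localObs_bounded`).

Modes with disjoint spectra have coprime characteristic polynomials, so over `2n` steps their output
spaces meet only in 0 (`obs_disjoint`). A large attack block can therefore be near the output space
of at most one mode, and an unbounded attack that fits every block predicts the mode at infinitely
many times (`exists_guess`). For a fixed attack sequence this has probability 0; independence and
Fubini extend this to random attacks (`ae_bounded_of_nearOutputs`). So the attack is bounded at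
every sensor.

A bounded attack with bounded residue biases gives bounded biases of the local estimates, because
the local observability maps are injective (`postDiff_bounded`). Fusion keeps them bounded, because
`W` is injective and the covariances are bounded and lie above `σ I`
(`NormBounded.weighted_least_squares`). -/

theorem vecMul_aeval_dotProduct_eq_sum (M : Matrix ι ι ℝ) (c x : ι → ℝ) (p : ℝ[X]) :
    (c ᵥ* aeval M p) ⬝ᵥ x
      = ∑ i ∈ Finset.range (p.natDegree + 1), p.coeff i * ((c ᵥ* M ^ i) ⬝ᵥ x) := by
  rw [aeval_eq_sum_range, ← Matrix.dotProduct_mulVec, Matrix.sum_mulVec, dotProduct_sum]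
  refine Finset.sum_congr rfl fun i _ => ?_
  rw [Matrix.smul_mulVec, dotProduct_smul, smul_eq_mul, Matrix.dotProduct_mulVec]

/-- If the first outputs of `(M, c)` from `x` vanish, then so do all outputs. -/
theorem vecMul_aeval_dotProduct_eq_zero (M : Matrix ι ι ℝ) (c x : ι → ℝ)
    (h : ∀ t < Fintype.card ι, (c ᵥ* M ^ t) ⬝ᵥ x = 0) (p : ℝ[X]) :
    (c ᵥ* aeval M p) ⬝ᵥ x = 0 := by
  -- Cayley–Hamilton: only the remainder modulo the characteristic polynomial counts, and its degree
  -- is below the dimension.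
  rw [aeval_eq_aeval_mod_charpoly, vecMul_aeval_dotProduct_eq_sum]
  refine Finset.sum_eq_zero fun i _ => ?_
  by_cases hi : i < Fintype.card ι
  · rw [h i hi, mul_zero]
  · have hdeg := degree_modByMonic_lt p (charpoly_monic M)
    rw [charpoly_degree_eq_dim] at hdeg
    rw [coeff_eq_zero_of_degree_lt (hdeg.trans_le (by exact_mod_cast not_lt.mp hi)), zero_mul]

theorem vecMul_pow_dotProduct_eq_zero (M : Matrix ι ι ℝ) (c x : ι → ℝ)
    (h : ∀ t < Fintype.card ι, (c ᵥ* M ^ t) ⬝ᵥ x = 0) (t : ℕ) :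
    (c ᵥ* M ^ t) ⬝ᵥ x = 0 := by
  simpa using vecMul_aeval_dotProduct_eq_zero M c x h (X ^ t)

theorem aeval_fromBlocks_diagonal {ι' : Type*} [Fintype ι'] [DecidableEq ι'] (A : Matrix ι ι ℝ)
    (B : Matrix ι' ι' ℝ) (p : ℝ[X]) :
    aeval (fromBlocks A 0 0 B) p = fromBlocks (aeval A p) 0 0 (aeval B p) := by
  induction p using Polynomial.induction_on' with
  | add p q hp hq => simp [hp, hq, fromBlocks_add]
  | monomial k a =>
    simp [← Polynomial.C_mul_X_pow_eq_monomial, fromBlocks_diagonal_pow, ← Algebra.smul_def,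
      fromBlocks_smul]

/-- Two systems with coprime characteristic polynomials and the same outputs over sufficiently many
steps have zero output. -/
theorem vecMul_pow_dotProduct_eq_zero_of_isCoprime {ι' : Type*} [Fintype ι'] [DecidableEq ι']
    (A : Matrix ι ι ℝ) (B : Matrix ι' ι' ℝ) (hAB : IsCoprime A.charpoly B.charpoly)
    (c x : ι → ℝ) (c' x' : ι' → ℝ)
    (h : ∀ t < Fintype.card ι + Fintype.card ι',
      (c ᵥ* A ^ t) ⬝ᵥ x = (c' ᵥ* B ^ t) ⬝ᵥ x') (t : ℕ) :
    (c ᵥ* A ^ t) ⬝ᵥ x = 0 := by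
  obtain ⟨u, v, huv⟩ := hAB
  -- The difference of the outputs is the output of one block-diagonal system, and it vanishes for
  -- as many steps as that system has dimensions. By Bézout the polynomial chosen below acts as `A ^
  -- t` on the first block and as 0 on the second.
  have key := vecMul_aeval_dotProduct_eq_zero (fromBlocks A 0 0 B) (Sum.elim c (-c'))
    (Sum.elim x x') (fun t ht => by
      rw [Fintype.card_sum] at ht
      rw [fromBlocks_diagonal_pow, vecMul_fromBlocks]
      simp [h t ht, neg_vecMul, sumElim_dotProduct_sumElim])
    (X ^ t * (v * B.charpoly))
  have hA : aeval A (v * B.charpoly) = 1 := by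
    have := congrArg (aeval A) huv
    simpa [aeval_self_charpoly] using this
  have hB : aeval B (v * B.charpoly) = 0 := by simp [aeval_self_charpoly]
  rw [aeval_fromBlocks_diagonal, map_mul (aeval A), map_mul (aeval B) (X ^ t), hA, hB,
    vecMul_fromBlocks] at key
  simpa [sumElim_dotProduct_sumElim] using key

end Matrix

theorem isCoprime_charpoly_of_disjoint_eigenvalueSet {n : ℕ} {A B : Matrix (Fin n) (Fin n) ℝ}
    (h : Disjoint (eigenvalueSet A) (eigenvalueSet B)) : IsCoprime A.charpoly B.charpoly := by
  refine (Polynomial.isCoprime_iff_aeval_ne_zero_of_isAlgClosed ℝ ℂ _ _).mpr ?_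
  intro a
  by_contra! hab
  have mem {M : Matrix (Fin n) (Fin n) ℝ} (hM : Polynomial.aeval a M.charpoly = 0) :
      a ∈ eigenvalueSet M := by
    rwa [eigenvalueSet, Matrix.mem_spectrum_iff_isRoot_charpoly, Matrix.charpoly_map,
      Polynomial.IsRoot, Polynomial.eval_map_algebraMap]
  exact Set.disjoint_left.mp h (mem hab.1) (mem hab.2)

/-! ### Coordinates of the observable part of a sensor -/

namespace SensorTransform

variable {n : ℕ} (T : SensorTransform n)

theorem Tuo_mul_Vuo_add : T.Tuo * T.Vuo + T.To * T.Vo = 1 := by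
  rw [← Matrix.fromCols_mul_fromRows, T.mul_inv]

theorem Vo_mul_Tuo : T.Vo * T.Tuo = 0 := by
  have := T.inv_mul
  rw [Matrix.fromRows_mul_fromCols, ← Matrix.fromBlocks_one, Matrix.fromBlocks_inj] at this
  exact this.2.2.1

theorem Vo_mul_To : T.Vo * T.To = 1 := by
  have := T.inv_mul
  rw [Matrix.fromRows_mul_fromCols, ← Matrix.fromBlocks_one, Matrix.fromBlocks_inj] at this
  exact this.2.2.2

theorem Vuo_mul_Tuo : T.Vuo * T.Tuo = 1 := by
  have := T.inv_mul
  rw [Matrix.fromRows_mul_fromCols, ← Matrix.fromBlocks_one, Matrix.fromBlocks_inj] at this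
  exact this.1

end SensorTransform

namespace HybridSystem

variable {n m l : ℕ} (G : HybridSystem n m l) (T : Fin m → SensorTransform n)

theorem obsMatrix_mulVec (s : Fin m) (t : ℕ) (j : Fin l) (x : Fin n → ℝ) (i : Fin t) :
    (G.obsMatrix s t j *ᵥ x) i = ((G.C j) s ᵥ* (G.A j) ^ (i : ℕ)) ⬝ᵥ x := rfl

theorem mem_unobservable {s : Fin m} {j : Fin l} {x : Fin n → ℝ} :
    x ∈ G.unobservable s j ↔ ∀ t < n, ((G.C j) s ᵥ* (G.A j) ^ t) ⬝ᵥ x = 0 := by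
  rw [unobservable, LinearMap.mem_ker, Matrix.mulVecLin_apply, funext_iff]
  simp only [obsMatrix_mulVec, Pi.zero_apply, Fin.forall_iff]

theorem vecMul_pow_Tuo {s : Fin m} {j : Fin l}
    (hT : LinearMap.range (T s).Tuo.mulVecLin = G.unobservable s j) (t : ℕ) :
    ((G.C j) s ᵥ* (G.A j) ^ t) ᵥ* (T s).Tuo = 0 := by
  refine dotProduct_eq _ _ fun y => ?_
  rw [← Matrix.dotProduct_mulVec, zero_dotProduct]
  refine Matrix.vecMul_pow_dotProduct_eq_zero _ _ _ (fun t ht => ?_) t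
  have hy : (T s).Tuo *ᵥ y ∈ G.unobservable s j := hT ▸ ⟨y, rfl⟩
  exact G.mem_unobservable.mp hy t (by simpa using ht)

/-- A row that vanishes on `Tuo` factors through `Vo`, since `Tuo * Vuo + To * Vo = 1`. Thus the
observable coordinates reproduce all outputs of the full state. -/
theorem localC_vecMul_pow_Vo {s : Fin m} {j : Fin l}
    (hT : LinearMap.range (T s).Tuo.mulVecLin = G.unobservable s j) (t : ℕ) :
    (G.localC T s j ᵥ* G.localA T s j ^ t) ᵥ* (T s).Vo = (G.C j) s ᵥ* (G.A j) ^ t := by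
  have split (c : Fin n → ℝ) (hc : c ᵥ* (T s).Tuo = 0) : (c ᵥ* (T s).To) ᵥ* (T s).Vo = c := by
    conv_rhs => rw [← Matrix.vecMul_one c, ← (T s).Tuo_mul_Vuo_add, Matrix.vecMul_add,
      ← Matrix.vecMul_vecMul, hc, Matrix.zero_vecMul, zero_add, ← Matrix.vecMul_vecMul]
  induction t with
  | zero =>
    have h0 := G.vecMul_pow_Tuo T hT 0
    simp only [pow_zero, Matrix.vecMul_one] at h0 ⊢
    exact split _ h0
  | succ t ih =>
    have h1 := G.vecMul_pow_Tuo T hT (t + 1)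
    rw [pow_succ, ← Matrix.vecMul_vecMul, localA, ← Matrix.vecMul_vecMul, ← Matrix.vecMul_vecMul,
      ← localA, ih]
    simp only [pow_succ, ← Matrix.vecMul_vecMul] at h1 ⊢
    exact split _ h1

/-- If `ζ` is invisible, then `To ζ` is unobservable, hence in the range of `Tuo`, which `Vo` kills.
-/
theorem local_observable {s : Fin m} {j : Fin l}
    (hT : LinearMap.range (T s).Tuo.mulVecLin = G.unobservable s j) {ζ : Fin (T s).r → ℝ}
    (h : ∀ t < n, (G.localC T s j ᵥ* G.localA T s j ^ t) ⬝ᵥ ζ = 0) : ζ = 0 := by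
  have hζ : (T s).Vo *ᵥ ((T s).To *ᵥ ζ) = ζ := by
    rw [Matrix.mulVec_mulVec, (T s).Vo_mul_To, Matrix.one_mulVec]
  have hmem : (T s).To *ᵥ ζ ∈ G.unobservable s j := by
    rw [mem_unobservable]
    intro t ht
    rw [← G.localC_vecMul_pow_Vo T hT, ← Matrix.dotProduct_mulVec, hζ]
    exact h t ht
  obtain ⟨y, hy⟩ := hT ▸ hmem
  rw [← hζ, ← hy, Matrix.mulVecLin_apply, Matrix.mulVec_mulVec, (T s).Vo_mul_Tuo,
    Matrix.zero_mulVec]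

/-- A common output comes from two modes of joint dimension `2n`, so agreement over `κ ≥ 2n` steps
suffices for the coprimality argument. -/
theorem obs_disjoint {κ : ℕ} (hκ : 2 * n ≤ κ) (s : Fin m) {i j : Fin l}
    (hij : Disjoint (eigenvalueSet (G.A i)) (eigenvalueSet (G.A j))) :
    Disjoint (LinearMap.range (G.obsMatrix s κ i).mulVecLin)
      (LinearMap.range (G.obsMatrix s κ j).mulVecLin) := by
  rw [Submodule.disjoint_def]
  rintro _ ⟨x, rfl⟩ ⟨x', hx'⟩
  ext t
  refine Matrix.vecMul_pow_dotProduct_eq_zero_of_isCoprime _ _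
    (isCoprime_charpoly_of_disjoint_eigenvalueSet hij) _ x ((G.C j) s) x' (fun t ht => ?_) t
  have ht' : t < κ := by simp only [Fintype.card_fin] at ht; omega
  exact (congrFun hx' ⟨t, ht'⟩).symm

/-- A vector that is close to the possible outputs of two subspaces that meet trivially is
bounded. -/
theorem _root_.Submodule.exists_bound_of_disjoint {E : Type*} [NormedAddCommGroup E]
    [NormedSpace ℝ E] [FiniteDimensional ℝ E] {U V : Submodule ℝ E} (h : Disjoint U V) (M : ℝ) :
    ∃ B : ℝ, ∀ b : E, ∀ u ∈ U, ∀ v ∈ V, ‖b - u‖ ≤ M → ‖b - v‖ ≤ M → ‖b‖ ≤ B := by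
  -- The map `(u, v) ↦ u - v` is injective, hence antilipschitz in finite dimension. A vector near
  -- both `u` and `v` makes `u - v` small, which bounds `u`.
  let f : U × V →ₗ[ℝ] E := U.subtype.coprod (-V.subtype)
  have hf : LinearMap.ker f = ⊥ := by
    rw [LinearMap.ker_eq_bot']
    rintro ⟨u, v⟩ huv
    have huv' : (u : E) = v := by
      simpa [f, ← sub_eq_add_neg, sub_eq_zero] using huv
    have hu : (u : E) = 0 := Submodule.disjoint_def.mp h u u.2 (huv' ▸ v.2)
    ext
    · exact hu
    · exact huv' ▸ hu
  obtain ⟨K, -, hK⟩ := f.exists_antilipschitzWith hf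
  refine ⟨M + K * (2 * M), fun b u hu v hv hbu hbv => ?_⟩
  have h1 := hK.le_mul_dist (⟨u, hu⟩, ⟨v, hv⟩) 0
  rw [dist_zero_right, map_zero, dist_zero_right] at h1
  have h2 : f (⟨u, hu⟩, ⟨v, hv⟩) = (b - v) - (b - u) := by simp [f]; abel
  have h3 : ‖f (⟨u, hu⟩, ⟨v, hv⟩)‖ ≤ 2 * M := by
    rw [h2]; exact (norm_sub_le _ _).trans (by linarith)
  have h4 : ‖u‖ ≤ K * (2 * M) :=
    ((norm_fst_le ((⟨u, hu⟩, ⟨v, hv⟩) : U × V)).trans h1).trans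
      (mul_le_mul_of_nonneg_left h3 K.2)
  calc ‖b‖ = ‖(b - u) + u‖ := by rw [sub_add_cancel]
    _ ≤ ‖b - u‖ + ‖u‖ := norm_add_le _ _
    _ ≤ _ := add_le_add hbu h4

end HybridSystem

/-! ### Families of cross-covariances -/

namespace Matrix

/-- The matrix with the blocks `P s₁ s₂`. -/
def ofBlocks {S : Type*} {ι : S → Type*} (P : ∀ s₁ s₂, Matrix (ι s₁) (ι s₂) ℝ) :
    Matrix (Σ s, ι s) (Σ s, ι s) ℝ :=
  of fun p p' => P p.1 p'.1 p.2 p'.2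

theorem ofBlocks_apply {S : Type*} {ι : S → Type*} (P : ∀ s₁ s₂, Matrix (ι s₁) (ι s₂) ℝ)
    (p p' : Σ s, ι s) : ofBlocks P p p' = P p.1 p'.1 p.2 p'.2 := rfl

theorem PosSemidef.of_ofBlocks {S : Type*} {ι : S → Type*} {P : ∀ s₁ s₂, Matrix (ι s₁) (ι s₂) ℝ}
    (hP : (ofBlocks P).PosSemidef) (s : S) : (P s s).PosSemidef :=
  hP.submatrix (Sigma.mk s)

variable {S : Type*} [Fintype S] [DecidableEq S] {ι ι' : S → Type*} [∀ s, Fintype (ι s)]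

theorem blockDiagonal'_mul_ofBlocks_mul (F : ∀ s, Matrix (ι' s) (ι s) ℝ)
    (P : ∀ s₁ s₂, Matrix (ι s₁) (ι s₂) ℝ) :
    blockDiagonal' F * ofBlocks P * (blockDiagonal' F)ᵀ
      = ofBlocks fun s₁ s₂ => F s₁ * P s₁ s₂ * (F s₂)ᵀ := by
  have h1 : blockDiagonal' F * ofBlocks P
      = of fun p (p' : Σ s, ι s) => (F p.1 * P p.1 p'.1) p.2 p'.2 := by
    ext ⟨s, i⟩ ⟨s', i'⟩
    rw [mul_apply, Fintype.sum_sigma, Finset.sum_eq_single s]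
    · simp [blockDiagonal'_apply_eq, ofBlocks_apply, mul_apply]
    · intro b _ hb
      exact Finset.sum_eq_zero fun k _ => by rw [blockDiagonal'_apply_ne _ _ _ hb.symm, zero_mul]
    · simp
  rw [h1]
  ext ⟨s, i⟩ ⟨s', i'⟩
  rw [mul_apply, Fintype.sum_sigma, Finset.sum_eq_single s']
  · simp only [of_apply, transpose_apply, blockDiagonal'_apply_eq, ofBlocks_apply]
    rw [mul_apply]
    simp only [transpose_apply]
  · intro b _ hb
    refine Finset.sum_eq_zero fun k _ => ?_
    rw [transpose_apply, blockDiagonal'_apply_ne _ _ _ hb.symm, mul_zero]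
  · simp

theorem PosSemidef.ofBlocks_conj [∀ s, Fintype (ι' s)] {P : ∀ s₁ s₂, Matrix (ι s₁) (ι s₂) ℝ}
    (hP : (ofBlocks P).PosSemidef) (F : ∀ s, Matrix (ι' s) (ι s) ℝ) :
    (ofBlocks fun s₁ s₂ => F s₁ * P s₁ s₂ * (F s₂)ᵀ).PosSemidef := by
  rw [← blockDiagonal'_mul_ofBlocks_mul, ← conjTranspose_eq_transpose_of_trivial]
  exact hP.mul_mul_conjTranspose_same _

/-- Test the form on `e_i ± e_j`. For the joint matrix of all sensors, this reduces
cross-covariances to variances. -/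
theorem PosSemidef.abs_apply_le {ι : Type*} [Fintype ι] [DecidableEq ι] {P : Matrix ι ι ℝ}
    (hP : P.PosSemidef) (i j : ι) : |P i j| ≤ (P i i + P j j) / 2 := by
  have hs : P j i = P i j := by simpa using (hP.isHermitian.apply i j)
  have h1 := hP.dotProduct_mulVec_nonneg (Pi.single i 1 + Pi.single j 1)
  have h2 := hP.dotProduct_mulVec_nonneg (Pi.single i 1 - Pi.single j 1)
  simp [mulVec_add, mulVec_sub, add_dotProduct, sub_dotProduct] at h1 h2
  rw [abs_le]
  constructor <;> linarith

end Matrix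

namespace HybridSystem

open Matrix

variable {n m l : ℕ} (G : HybridSystem n m l) (T : Fin m → SensorTransform n)

/-- Both summands are congruences by block-diagonal matrices: one of the joint prior covariance, one
of `R` seen as a family of `1 × 1` blocks. -/
theorem posSemidef_ofBlocks_covUpdate (j : Fin l)
    {P : ∀ s₁ s₂ : Fin m, Matrix (Fin (T s₁).r) (Fin (T s₂).r) ℝ}
    (hP : (ofBlocks P).PosSemidef) : (ofBlocks (G.covUpdate T j P)).PosSemidef := by
  have h1 := hP.ofBlocks_conj fun s => G.updFactor T s j (P s s)
  have h2 : (ofBlocks fun s₁ s₂ : Fin m =>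
      (of fun _ _ => G.R s₁ s₂ : Matrix (Fin 1) (Fin 1) ℝ)).PosSemidef :=
    G.R_posDef.posSemidef.submatrix Sigma.fst
  have h3 := h2.ofBlocks_conj fun s => replicateCol (Fin 1) (G.gain T s j (P s s))
  convert h1.add h3 using 1
  ext p p'
  simp only [ofBlocks_apply, covUpdate, Matrix.add_apply, Matrix.smul_apply, vecMulVec_apply,
    smul_eq_mul]
  congr 1
  simp [Matrix.mul_apply]
  ring

theorem posSemidef_ofBlocks_const {Q : Matrix (Fin n) (Fin n) ℝ} (hQ : Q.PosSemidef) :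
    (ofBlocks fun s₁ s₂ : Fin m => (T s₁).Vo * Q * (T s₂).Voᵀ).PosSemidef := by
  have h : (ofBlocks (ι := fun _ : Fin m => Fin n) fun _ _ => Q).PosSemidef :=
    hQ.submatrix fun p : Σ _ : Fin m, Fin n => p.2
  exact h.ofBlocks_conj fun s => (T s).Vo

theorem posSemidef_ofBlocks_priorCov (μ : ℕ → Fin l) (k : ℕ) :
    (ofBlocks (G.priorCov T μ k)).PosSemidef := by
  induction k with
  | zero => exact posSemidef_ofBlocks_const T G.P0_posSemidef
  | succ k ih =>
    exact ((G.posSemidef_ofBlocks_covUpdate T (μ k) ih).ofBlocks_conj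
      fun s => G.localA T s (μ k)).add (posSemidef_ofBlocks_const T G.Q_posSemidef)

theorem posSemidef_ofBlocks_postCov (μ : ℕ → Fin l) (k : ℕ) :
    (ofBlocks (G.postCov T μ k)).PosSemidef :=
  G.posSemidef_ofBlocks_covUpdate T (μ k) (G.posSemidef_ofBlocks_priorCov T μ k)

theorem posSemidef_priorCov (μ : ℕ → Fin l) (k : ℕ) (s : Fin m) :
    (G.priorCov T μ k s s).PosSemidef :=
  (G.posSemidef_ofBlocks_priorCov T μ k).of_ofBlocks s

theorem posSemidef_postCov (μ : ℕ → Fin l) (k : ℕ) (s : Fin m) :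
    (G.postCov T μ k s s).PosSemidef :=
  (G.posSemidef_ofBlocks_postCov T μ k).of_ofBlocks s

theorem R_diag_pos (s : Fin m) : 0 < G.R s s := G.R_posDef.diag_pos

variable {T}

theorem le_innovVar {s : Fin m} {j : Fin l} {P : Matrix (Fin (T s).r) (Fin (T s).r) ℝ}
    (hP : P.PosSemidef) : G.R s s ≤ G.innovVar T s j P := by
  have := hP.dotProduct_mulVec_nonneg (G.localC T s j)
  simp only [star_trivial] at this
  rw [innovVar]
  linarith

theorem updFactor_transpose_mulVec (s : Fin m) (j : Fin l)
    (P : Matrix (Fin (T s).r) (Fin (T s).r) ℝ) (x : Fin (T s).r → ℝ) :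
    (G.updFactor T s j P)ᵀ *ᵥ x = x - (G.gain T s j P ⬝ᵥ x) • G.localC T s j := by
  rw [updFactor, transpose_sub, transpose_one, sub_mulVec, one_mulVec, transpose_vecMulVec,
    vecMulVec_mulVec, op_smul_eq_smul]

theorem updFactor_mulVec (s : Fin m) (j : Fin l)
    (P : Matrix (Fin (T s).r) (Fin (T s).r) ℝ) (x : Fin (T s).r → ℝ) :
    G.updFactor T s j P *ᵥ x = x - (G.localC T s j ⬝ᵥ x) • G.gain T s j P := by
  rw [updFactor, sub_mulVec, one_mulVec, vecMulVec_mulVec, op_smul_eq_smul]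

theorem dotProduct_conj_mulVec {ι ι' : Type*} [Fintype ι] [Fintype ι'] (F : Matrix ι ι' ℝ)
    (P : Matrix ι' ι' ℝ) (x : ι → ℝ) :
    x ⬝ᵥ ((F * P * Fᵀ) *ᵥ x) = (Fᵀ *ᵥ x) ⬝ᵥ (P *ᵥ (Fᵀ *ᵥ x)) := by
  rw [← mulVec_mulVec, ← mulVec_mulVec, dotProduct_mulVec, ← mulVec_transpose]

/-- The Kalman gain is optimal: every other gain gives a larger a posteriori variance. -/
theorem covUpdate_quadratic_le (s : Fin m) (j : Fin l)
    {P : ∀ s₁ s₂ : Fin m, Matrix (Fin (T s₁).r) (Fin (T s₂).r) ℝ}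
    (hP : (P s s).PosSemidef) (x : Fin (T s).r → ℝ) (a : ℝ) :
    x ⬝ᵥ (G.covUpdate T j P s s *ᵥ x)
      ≤ (x - a • G.localC T s j) ⬝ᵥ (P s s *ᵥ (x - a • G.localC T s j)) + G.R s s * a ^ 2 := by
  have hS : 0 < G.innovVar T s j (P s s) := (G.R_diag_pos s).trans_le (G.le_innovVar hP)
  have hsymm : x ⬝ᵥ (P s s *ᵥ G.localC T s j) = G.localC T s j ⬝ᵥ (P s s *ᵥ x) := by
    have ht : (P s s)ᵀ = P s s := by simpa using hP.isHermitian.eq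
    rw [dotProduct_mulVec, ← mulVec_transpose, ht, dotProduct_comm]
  have hg : G.gain T s j (P s s) ⬝ᵥ x
      = (G.innovVar T s j (P s s))⁻¹ * (G.localC T s j ⬝ᵥ (P s s *ᵥ x)) := by
    rw [gain, smul_dotProduct, smul_eq_mul, dotProduct_comm, hsymm]
  -- Completing the square: this is a quadratic in the scalar, with the innovation variance as
  -- leading coefficient, and the Kalman gain picks its minimum.
  have expand (b : ℝ) :
      (x - b • G.localC T s j) ⬝ᵥ (P s s *ᵥ (x - b • G.localC T s j)) + G.R s s * b ^ 2
        = x ⬝ᵥ (P s s *ᵥ x) - 2 * b * (G.localC T s j ⬝ᵥ (P s s *ᵥ x))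
          + b ^ 2 * G.innovVar T s j (P s s) := by
    simp only [mulVec_sub, mulVec_smul, sub_dotProduct, dotProduct_sub, smul_dotProduct,
      dotProduct_smul, smul_eq_mul, hsymm, innovVar]
    ring
  have hl : x ⬝ᵥ (G.covUpdate T j P s s *ᵥ x)
      = (x - (G.gain T s j (P s s) ⬝ᵥ x) • G.localC T s j) ⬝ᵥ
          (P s s *ᵥ (x - (G.gain T s j (P s s) ⬝ᵥ x) • G.localC T s j))
        + G.R s s * (G.gain T s j (P s s) ⬝ᵥ x) ^ 2 := by
    rw [covUpdate, add_mulVec, dotProduct_add, dotProduct_conj_mulVec,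
      updFactor_transpose_mulVec, smul_mulVec, vecMulVec_mulVec, op_smul_eq_smul, dotProduct_smul,
      dotProduct_smul, dotProduct_comm x]
    simp only [smul_eq_mul]
    ring
  rw [hl, expand, expand, hg]
  set S := G.innovVar T s j (P s s)
  set b := G.localC T s j ⬝ᵥ (P s s *ᵥ x)
  have : 0 ≤ (a * S - b) ^ 2 / S := by positivity
  have e : (a * S - b) ^ 2 / S = a ^ 2 * S - 2 * a * b + S⁻¹ * b ^ 2 := by field_simp; ring
  have e' : (S⁻¹ * b) ^ 2 * S = S⁻¹ * b ^ 2 := by field_simp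
  rw [e']
  nlinarith

end HybridSystem

/-! ### Bounded families -/

/-- The family `f` is bounded in norm. -/
def NormBounded {ι E : Type*} [Norm E] (f : ι → E) : Prop := ∃ B : ℝ, ∀ k, ‖f k‖ ≤ B

namespace NormBounded

variable {ι E : Type*} [SeminormedAddCommGroup E] {f g : ι → E}

theorem mono {f' : ι → ℝ} (h : NormBounded f') (hf : ∀ k, ‖f k‖ ≤ f' k) : NormBounded f :=
  let ⟨B, hB⟩ := h
  ⟨B, fun k => (hf k).trans ((Real.le_norm_self _).trans (hB k))⟩

theorem add (hf : NormBounded f) (hg : NormBounded g) : NormBounded fun k => f k + g k :=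
  let ⟨A, hA⟩ := hf
  let ⟨B, hB⟩ := hg
  ⟨A + B, fun k => (norm_add_le _ _).trans (add_le_add (hA k) (hB k))⟩

theorem neg (hf : NormBounded f) : NormBounded fun k => -f k :=
  let ⟨A, hA⟩ := hf
  ⟨A, fun k => (norm_neg (f k)).trans_le (hA k)⟩

theorem sub (hf : NormBounded f) (hg : NormBounded g) : NormBounded fun k => f k - g k := by
  simpa [sub_eq_add_neg] using hf.add hg.neg

theorem smul [NormedSpace ℝ E] {a : ι → ℝ} (ha : NormBounded a) (hf : NormBounded f) :
    NormBounded fun k => a k • f k :=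
  let ⟨A, hA⟩ := ha
  let ⟨B, hB⟩ := hf
  ⟨A * B, fun k => (norm_smul_le _ _).trans
    (mul_le_mul (hA k) (hB k) (norm_nonneg _) ((norm_nonneg _).trans (hA k)))⟩

theorem mul {a b : ι → ℝ} (ha : NormBounded a) (hb : NormBounded b) :
    NormBounded fun k => a k * b k := ha.smul hb

theorem const (c : E) : NormBounded fun _ : ι => c := ⟨‖c‖, fun _ => le_rfl⟩

theorem comp {ι' : Type*} (hf : NormBounded f) (h : ι' → ι) : NormBounded fun k => f (h k) :=
  let ⟨A, hA⟩ := hf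
  ⟨A, fun k => hA (h k)⟩

theorem sum {τ : Type*} {F : τ → ι → E} (s : Finset τ) (h : ∀ c ∈ s, NormBounded (F c)) :
    NormBounded fun k => ∑ c ∈ s, F c k := by
  classical
  induction s using Finset.induction_on with
  | empty => simpa using const (ι := ι) (0 : E)
  | insert c s hc ih =>
    simp only [Finset.sum_insert hc]
    exact (h c (by simp)).add (ih fun b hb => h b (by simp [hb]))

/-- This is how bounds become uniform in time: the mode and the position in a block take only
finitely many values. -/
theorem of_finite_fibers {τ : Type*} [Finite τ] (h : ι → τ)
    (H : ∀ c, ∃ B : ℝ, ∀ k, h k = c → ‖f k‖ ≤ B) : NormBounded f := by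
  choose B hB using H
  obtain ⟨M, hM⟩ := (Set.finite_range B).bddAbove
  exact ⟨M, fun k => (hB _ k rfl).trans (hM ⟨_, rfl⟩)⟩

theorem pi {τ : Type*} [Fintype τ] {F : ι → τ → ℝ} (h : ∀ c, NormBounded fun k => F k c) :
    NormBounded F := by
  choose B hB using h
  obtain ⟨M, hM⟩ := (Set.finite_range B).bddAbove
  refine ⟨max M 0, fun k => (pi_norm_le_iff_of_nonneg (le_max_right _ _)).mpr fun c => ?_⟩
  exact (hB c k).trans ((hM ⟨c, rfl⟩).trans (le_max_left _ _))

theorem apply {τ : Type*} [Fintype τ] {F : ι → τ → ℝ} (h : NormBounded F) (c : τ) :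
    NormBounded fun k => F k c :=
  let ⟨B, hB⟩ := h
  ⟨B, fun k => (norm_le_pi_norm (F k) c).trans (hB k)⟩

theorem mulVec {τ τ' : Type*} [Fintype τ] [Fintype τ'] {M : ι → Matrix τ' τ ℝ} {F : ι → τ → ℝ}
    (hM : ∀ i j, NormBounded fun k => M k i j) (hF : NormBounded F) :
    NormBounded fun k => M k *ᵥ F k :=
  pi fun i => sum Finset.univ fun j _ => (hM i j).mul (hF.apply j)

theorem dotProduct {τ : Type*} [Fintype τ] {F F' : ι → τ → ℝ}
    (hF : NormBounded F) (hF' : NormBounded F') : NormBounded fun k => F k ⬝ᵥ F' k :=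
  sum Finset.univ fun j _ => (hF.apply j).mul (hF'.apply j)

theorem of_finite {τ : Type*} [Finite τ] (F : τ → E) (h : ι → τ) :
    NormBounded fun k => F (h k) :=
  of_finite_fibers h fun c => ⟨‖F c‖, fun k hk => by rw [hk]⟩

/-- A vector is bounded if its image under one of finitely many injective maps is. -/
theorem of_injective_image {τ V W : Type*} [Finite τ] [NormedAddCommGroup V] [NormedSpace ℝ V]
    [FiniteDimensional ℝ V] [NormedAddCommGroup W] [NormedSpace ℝ W] (Φ : τ → V →ₗ[ℝ] W)
    (hΦ : ∀ c, LinearMap.ker (Φ c) = ⊥) (h : ι → τ) {x : ι → V}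
    (hx : NormBounded fun k => Φ (h k) (x k)) : NormBounded x := by
  obtain ⟨B, hB⟩ := hx
  refine of_finite_fibers h fun c => ?_
  obtain ⟨K, -, hK⟩ := (Φ c).exists_antilipschitzWith (hΦ c)
  refine ⟨K * B, fun k hk => ?_⟩
  have h1 := hK.le_mul_dist (x k) 0
  rw [dist_zero_right, map_zero, dist_zero_right] at h1
  exact h1.trans (mul_le_mul_of_nonneg_left (hk ▸ hB k) K.2)

end NormBounded

/-! ### Boundedness of the covariances -/

namespace HybridSystem

open Matrix

variable {n m l : ℕ} (G : HybridSystem n m l) (T : Fin m → SensorTransform n)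

theorem local_obs_injective {κ : ℕ} (hκ : n ≤ κ) {s : Fin m} {j : Fin l}
    (hT : LinearMap.range (T s).Tuo.mulVecLin = G.unobservable s j) :
    LinearMap.ker (Matrix.of fun t : Fin κ =>
      G.localC T s j ᵥ* G.localA T s j ^ (t : ℕ)).mulVecLin = ⊥ := by
  rw [LinearMap.ker_eq_bot']
  intro ζ hζ
  exact G.local_observable T hT fun t ht => congrFun hζ ⟨t, ht.trans_le hκ⟩

/-- Duality: the observability map is injective, so it has a left inverse, and applying that to `y`
from the other side gives the coefficients. -/
theorem local_controllable {κ : ℕ} (hκ : n ≤ κ) {s : Fin m} {j : Fin l}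
    (hT : LinearMap.range (T s).Tuo.mulVecLin = G.unobservable s j) (y : Fin (T s).r → ℝ) :
    ∃ a : ℕ → ℝ,
      ∑ t ∈ Finset.range κ, a t • (G.localC T s j ᵥ* G.localA T s j ^ t) = y := by
  obtain ⟨g, hg⟩ := LinearMap.exists_leftInverse_of_injective _ (G.local_obs_injective T hκ hT)
  set O : Matrix (Fin κ) (Fin (T s).r) ℝ :=
    Matrix.of fun t : Fin κ => G.localC T s j ᵥ* G.localA T s j ^ (t : ℕ) with hO
  have hg' : LinearMap.toMatrix' g * O = 1 := by
    rw [← LinearMap.toMatrix'_toLin' O, ← LinearMap.toMatrix'_comp, toLin'_apply', hg,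
      LinearMap.toMatrix'_id]
  refine ⟨fun t => if ht : t < κ then (y ᵥ* LinearMap.toMatrix' g) ⟨t, ht⟩ else 0, ?_⟩
  have hy : (y ᵥ* LinearMap.toMatrix' g) ᵥ* O = y := by rw [vecMul_vecMul, hg', vecMul_one]
  conv_rhs => rw [← hy, vecMul_eq_sum]
  rw [Finset.sum_range]
  refine Finset.sum_congr rfl fun t _ => ?_
  simp only [dif_pos t.2]
  rfl

variable {T}

/-- The variance recursion read backwards as a control problem: `x` is the dual state, `a` a free
control, and the last bracket its running cost. -/
theorem priorCov_succ_quadratic_le (μ : ℕ → Fin l) (k : ℕ) (s : Fin m) (x : Fin (T s).r → ℝ)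
    (a : ℝ) :
    x ⬝ᵥ (G.priorCov T μ (k + 1) s s *ᵥ x)
      ≤ (x ᵥ* G.localA T s (μ k) - a • G.localC T s (μ k)) ⬝ᵥ (G.priorCov T μ k s s *ᵥ
          (x ᵥ* G.localA T s (μ k) - a • G.localC T s (μ k)))
        + (G.R s s * a ^ 2 + x ⬝ᵥ (((T s).Vo * G.Q * (T s).Voᵀ) *ᵥ x)) := by
  rw [priorCov, add_mulVec, dotProduct_add, dotProduct_conj_mulVec, mulVec_transpose, ← add_assoc]
  exact add_le_add_left (G.covUpdate_quadratic_le s (μ k) (G.posSemidef_priorCov T μ k s) _ a) _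

/-- Bound for the variances over `t` steps in one mode, for an arbitrary dual control `a`. -/
theorem priorCov_add_quadratic_le (μ : ℕ → Fin l) (s : Fin m) (j : Fin l) (a : ℕ → ℝ) (t : ℕ)
    (x : Fin (T s).r → ℝ) :
    ∃ B : ℝ, ∀ k, (∀ i < t, μ (k + i) = j) →
      x ⬝ᵥ (G.priorCov T μ (k + t) s s *ᵥ x)
        ≤ (x ᵥ* G.localA T s j ^ t
            - ∑ i ∈ Finset.range t, a i • (G.localC T s j ᵥ* G.localA T s j ^ i)) ⬝ᵥ
          (G.priorCov T μ k s s *ᵥ (x ᵥ* G.localA T s j ^ t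
            - ∑ i ∈ Finset.range t, a i • (G.localC T s j ᵥ* G.localA T s j ^ i))) + B := by
  induction t generalizing x with
  | zero => exact ⟨0, fun k _ => by simp⟩
  | succ t ih =>
    -- The latest time step is peeled off first; its control `a t` then passes through `t` earlier
    -- steps and acquires the factor `localA ^ t`.
    obtain ⟨B, hB⟩ := ih (x ᵥ* G.localA T s j - a t • G.localC T s j)
    refine ⟨B + (G.R s s * a t ^ 2 + x ⬝ᵥ (((T s).Vo * G.Q * (T s).Voᵀ) *ᵥ x)), fun k hk => ?_⟩
    have h1 := G.priorCov_succ_quadratic_le μ (k + t) s x (a t)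
    rw [hk t (Nat.lt_succ_self t)] at h1
    have h2 := hB k fun i hi => hk i (hi.trans (Nat.lt_succ_self t))
    have e : (x ᵥ* G.localA T s j - a t • G.localC T s j) ᵥ* G.localA T s j ^ t
          - ∑ i ∈ Finset.range t, a i • (G.localC T s j ᵥ* G.localA T s j ^ i)
        = x ᵥ* G.localA T s j ^ (t + 1)
          - ∑ i ∈ Finset.range (t + 1), a i • (G.localC T s j ᵥ* G.localA T s j ^ i) := by
      rw [Finset.sum_range_succ, sub_vecMul, smul_vecMul, vecMul_vecMul, ← pow_succ']
      abel
    rw [e] at h2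
    rw [← add_assoc k t 1]
    linarith

/-! ### Bounds along a mode sequence that is constant on blocks -/

section Path

variable {κ : ℕ} {μ : ℕ → Fin l}

theorem mode_add (hμ : ∀ k, μ k = μ (κ * (k / κ))) {t : ℕ} (ht : t < κ) (i : ℕ) :
    μ (κ * i + t) = μ (κ * i) := by
  rw [hμ (κ * i + t), Nat.mul_add_div (by omega), Nat.div_eq_of_lt ht, add_zero]

theorem priorCov_quadratic_bounded (hκ : n ≤ κ) (hκ0 : 0 < κ) (hμ : ∀ k, μ k = μ (κ * (k / κ)))
    {s : Fin m} (hT : ∀ j, LinearMap.range (T s).Tuo.mulVecLin = G.unobservable s j)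
    (x : Fin (T s).r → ℝ) : NormBounded fun k => x ⬝ᵥ (G.priorCov T μ k s s *ᵥ x) := by
  have habs (k : ℕ) (x : Fin (T s).r → ℝ) :
      ‖x ⬝ᵥ (G.priorCov T μ k s s *ᵥ x)‖ = x ⬝ᵥ (G.priorCov T μ k s s *ᵥ x) := by
    have := (G.posSemidef_priorCov T μ k s).dotProduct_mulVec_nonneg x
    exact Real.norm_of_nonneg (by simpa using this)
  have hstart (x : Fin (T s).r → ℝ) :
      NormBounded fun i => x ⬝ᵥ (G.priorCov T μ (κ * i) s s *ᵥ x) := by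
    -- Block starts are sorted by the mode of the preceding block; `none` stands for time 0, which
    -- has no predecessor.
    refine NormBounded.of_finite_fibers
      (fun i => if i = 0 then none else some (μ (κ * (i - 1)))) fun c => ?_
    cases c with
    | none =>
      refine ⟨x ⬝ᵥ (G.priorCov T μ 0 s s *ᵥ x), fun i hi => ?_⟩
      cases i with
      | zero => exact (habs _ _).le
      | succ i => simp at hi
    | some j =>
      -- A dead-beat control: it steers the dual state to 0 over one block, so the covariance at the
      -- start of that block drops out of the bound.
      obtain ⟨a, ha⟩ := G.local_controllable T hκ (hT j) (x ᵥ* G.localA T s j ^ κ)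
      obtain ⟨B, hB⟩ := G.priorCov_add_quadratic_le μ s j a κ x
      refine ⟨B, fun i hi => ?_⟩
      cases i with
      | zero => simp at hi
      | succ i =>
        have hi' : μ (κ * i) = j := by simpa using hi
        have := hB (κ * i) fun t ht => (mode_add hμ ht i).trans hi'
        rw [ha, sub_self, zero_dotProduct, zero_add] at this
        rw [habs]
        exact this
  refine NormBounded.of_finite_fibers
    (fun k => ((⟨k % κ, Nat.mod_lt k hκ0⟩ : Fin κ), μ (κ * (k / κ)))) fun c => ?_
  obtain ⟨t, j⟩ := c
  -- Inside a block the control 0 is enough, since fewer than `κ` steps are made from its start.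
  obtain ⟨B, hB⟩ := G.priorCov_add_quadratic_le μ s j 0 t x
  obtain ⟨B', hB'⟩ := hstart (x ᵥ* G.localA T s j ^ (t : ℕ))
  refine ⟨B' + B, fun k hk => ?_⟩
  obtain ⟨hkt, hkj⟩ := Prod.mk.inj hk
  have hkt : k % κ = t := Fin.ext_iff.mp hkt
  have h1 := hB (κ * (k / κ)) fun i hi => (mode_add hμ (hi.trans t.2) _).trans hkj
  have h2 := hB' (k / κ)
  have e : κ * (k / κ) + t = k := by rw [← hkt, Nat.div_add_mod]
  simp only [Pi.zero_apply, zero_smul, Finset.sum_const_zero, sub_zero, e] at h1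
  rw [habs] at h2 ⊢
  linarith

theorem priorCov_bounded (hκ : n ≤ κ) (hκ0 : 0 < κ) (hμ : ∀ k, μ k = μ (κ * (k / κ)))
    {s : Fin m} (hT : ∀ j, LinearMap.range (T s).Tuo.mulVecLin = G.unobservable s j)
    (i i' : Fin (T s).r) : NormBounded fun k => G.priorCov T μ k s s i i' := by
  have hdiag (i : Fin (T s).r) : NormBounded fun k => G.priorCov T μ k s s i i := by
    simpa using G.priorCov_quadratic_bounded hκ hκ0 hμ hT (Pi.single i 1)
  refine (((hdiag i).add (hdiag i')).mul (.const (1 / 2))).mono fun k => ?_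
  rw [Real.norm_eq_abs, mul_one_div]
  exact (G.posSemidef_priorCov T μ k s).abs_apply_le i i'

theorem postCov_bounded (hκ : n ≤ κ) (hκ0 : 0 < κ) (hμ : ∀ k, μ k = μ (κ * (k / κ)))
    (hT : ∀ s j, LinearMap.range (T s).Tuo.mulVecLin = G.unobservable s j) (s s' : Fin m)
    (i : Fin (T s).r) (i' : Fin (T s').r) : NormBounded fun k => G.postCov T μ k s s' i i' := by
  have hdiag (s : Fin m) (i : Fin (T s).r) : NormBounded fun k => G.postCov T μ k s s i i := by
    refine (G.priorCov_quadratic_bounded hκ hκ0 hμ (hT s) (Pi.single i 1)).mono fun k => ?_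
    have h0 := (G.posSemidef_postCov T μ k s).diag_nonneg (i := i)
    -- Comparison with the zero gain: a measurement update does not increase variances.
    have h1 := G.covUpdate_quadratic_le s (μ k) (G.posSemidef_priorCov T μ k s)
      (Pi.single i 1) 0
    rw [Real.norm_of_nonneg h0]
    simpa [postCov] using h1
  refine (((hdiag s i).add (hdiag s' i')).mul (.const (1 / 2))).mono fun k => ?_
  rw [Real.norm_eq_abs, mul_one_div]
  exact (G.posSemidef_ofBlocks_postCov T μ k).abs_apply_le ⟨s, i⟩ ⟨s', i'⟩

theorem innovVar_bounded (hκ : n ≤ κ) (hκ0 : 0 < κ) (hμ : ∀ k, μ k = μ (κ * (k / κ)))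
    {s : Fin m} (hT : ∀ j, LinearMap.range (T s).Tuo.mulVecLin = G.unobservable s j) :
    NormBounded fun k => G.innovVar T s (μ k) (G.priorCov T μ k s s) := by
  have hc : NormBounded fun k => G.localC T s (μ k) := .of_finite _ μ
  exact (hc.dotProduct (hc.mulVec (G.priorCov_bounded hκ hκ0 hμ hT))).add (.const _)

theorem gain_bounded (hκ : n ≤ κ) (hκ0 : 0 < κ) (hμ : ∀ k, μ k = μ (κ * (k / κ)))
    {s : Fin m} (hT : ∀ j, LinearMap.range (T s).Tuo.mulVecLin = G.unobservable s j) :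
    NormBounded fun k => G.gain T s (μ k) (G.priorCov T μ k s s) := by
  have hc : NormBounded fun k => G.localC T s (μ k) := .of_finite _ μ
  refine .smul ⟨(G.R s s)⁻¹, fun k => ?_⟩ (hc.mulVec (G.priorCov_bounded hκ hκ0 hμ hT))
  have h := G.le_innovVar (j := μ k) (G.posSemidef_priorCov T μ k s)
  rw [Real.norm_of_nonneg (inv_nonneg.mpr ((G.R_diag_pos s).le.trans h))]
  exact inv_anti₀ (G.R_diag_pos s) h

end Path

end HybridSystem

/-! ### Biases of the local filters -/

namespace HybridSystem

open Matrix

variable {n m l : ℕ} (G : HybridSystem n m l) {T : Fin m → SensorTransform n}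
  {κ : ℕ} {μ : ℕ → Fin l} {y y' : ℕ → Fin m → ℝ} {s : Fin m}

theorem estUpdate_eq (k : ℕ) (ζ : Fin (T s).r → ℝ) (η : ℝ) :
    G.estUpdate T μ k s ζ η
      = ζ + (η - G.localC T s (μ k) ⬝ᵥ ζ) • G.gain T s (μ k) (G.priorCov T μ k s s) := by
  rw [estUpdate, updFactor_mulVec]
  module

variable (T μ y y' s) in
/-- Difference of the a priori estimates for two measurement sequences. -/
def priorDiff (k : ℕ) : Fin (T s).r → ℝ := G.priorEst T μ y k s - G.priorEst T μ y' k s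

variable (T μ y y' s) in
/-- Difference of the innovations for two measurement sequences. -/
def innovDiff (k : ℕ) : ℝ := y k s - y' k s - G.localC T s (μ k) ⬝ᵥ G.priorDiff T μ y y' s k

variable (T μ y y' s) in
/-- Difference of the corrections for two measurement sequences. -/
def correctionDiff (k : ℕ) : Fin (T s).r → ℝ :=
  G.innovDiff T μ y y' s k • G.gain T s (μ k) (G.priorCov T μ k s s)

theorem estUpdate_sub_estUpdate (k : ℕ) :
    G.estUpdate T μ k s (G.priorEst T μ y k s) (y k s)
      - G.estUpdate T μ k s (G.priorEst T μ y' k s) (y' k s)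
      = G.priorDiff T μ y y' s k + G.correctionDiff T μ y y' s k := by
  rw [estUpdate_eq, estUpdate_eq, correctionDiff, innovDiff, priorDiff, dotProduct_sub]
  module

theorem postEst_sub_postEst (k : ℕ) :
    G.postEst T μ y k s - G.postEst T μ y' k s
      = G.priorDiff T μ y y' s k + G.correctionDiff T μ y y' s k :=
  G.estUpdate_sub_estUpdate k

/-- Both runs share modes, covariances and gains, so their difference is a linear system driven by
the corrections alone. -/
theorem priorDiff_succ (k : ℕ) :
    G.priorDiff T μ y y' s (k + 1)
      = G.localA T s (μ k) *ᵥ (G.priorDiff T μ y y' s k + G.correctionDiff T μ y y' s k) := by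
  rw [← estUpdate_sub_estUpdate, mulVec_sub]
  rfl

theorem residue_sub_residue (k : ℕ) :
    G.residue T μ y k s - G.residue T μ y' k s
      = G.innovDiff T μ y y' s k
        / Real.sqrt (G.innovVar T s (μ k) (G.priorCov T μ k s s)) := by
  rw [residue, residue, ← sub_div, innovDiff, priorDiff, dotProduct_sub]
  congr 1
  ring

/-- The innovation variance is bounded above, so the normalization of the residues can be undone. -/
theorem innovDiff_bounded (hκ : n ≤ κ) (hκ0 : 0 < κ) (hμ : ∀ k, μ k = μ (κ * (k / κ)))
    (hT : ∀ j, LinearMap.range (T s).Tuo.mulVecLin = G.unobservable s j)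
    (hz : NormBounded fun k => G.residue T μ y k s - G.residue T μ y' k s) :
    NormBounded (G.innovDiff T μ y y' s) := by
  have hsqrt : NormBounded fun k =>
      Real.sqrt (G.innovVar T s (μ k) (G.priorCov T μ k s s)) := by
    obtain ⟨B, hB⟩ := G.innovVar_bounded hκ hκ0 hμ hT
    refine ⟨Real.sqrt B, fun k => ?_⟩
    rw [Real.norm_of_nonneg (Real.sqrt_nonneg _)]
    exact Real.sqrt_le_sqrt ((Real.le_norm_self _).trans (hB k))
  convert hz.mul hsqrt using 2 with k
  have h := (G.R_diag_pos s).trans_le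
    (G.le_innovVar (j := μ k) (G.posSemidef_priorCov T μ k s))
  rw [residue_sub_residue, div_mul_cancel₀ _ (Real.sqrt_pos.mpr h).ne']

theorem correctionDiff_bounded (hκ : n ≤ κ) (hκ0 : 0 < κ) (hμ : ∀ k, μ k = μ (κ * (k / κ)))
    (hT : ∀ j, LinearMap.range (T s).Tuo.mulVecLin = G.unobservable s j)
    (hz : NormBounded fun k => G.residue T μ y k s - G.residue T μ y' k s) :
    NormBounded (G.correctionDiff T μ y y' s) :=
  (G.innovDiff_bounded hκ hκ0 hμ hT hz).smul (G.gain_bounded hκ hκ0 hμ hT)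

theorem localA_mulVec_bounded {ι : Type*} (h : ι → Fin l) {x : ι → Fin (T s).r → ℝ}
    (hx : NormBounded x) : NormBounded fun i => G.localA T s (h i) *ᵥ x i :=
  .mulVec (fun a b => .of_finite (fun j => G.localA T s j a b) h) hx

/-- Fewer than `κ` bounded corrections accumulate within a block, so no stability of the modes is
needed. -/
theorem priorDiff_block_bounded (hμ : ∀ k, μ k = μ (κ * (k / κ)))
    (hu : NormBounded (G.correctionDiff T μ y y' s)) {t : ℕ} (ht : t < κ) :
    NormBounded fun i => G.priorDiff T μ y y' s (κ * i + t)
      - G.localA T s (μ (κ * i)) ^ t *ᵥ G.priorDiff T μ y y' s (κ * i) := by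
  induction t with
  | zero => simpa using NormBounded.const (ι := ℕ) (0 : Fin (T s).r → ℝ)
  | succ t ih =>
    have h1 := G.localA_mulVec_bounded (fun i => μ (κ * i))
      ((ih (by omega)).add (hu.comp fun i => κ * i + t))
    convert h1 using 2 with i
    rw [← add_assoc, priorDiff_succ, mode_add hμ (by omega), pow_succ', ← mulVec_mulVec,
      ← mulVec_sub]
    congr 1
    abel

/-- With bounded residues, in each block the difference of the measurements is close to a possible
output of the mode of that block. -/
theorem measDiff_sub_localObs_bounded (hκ : n ≤ κ) (hκ0 : 0 < κ)
    (hμ : ∀ k, μ k = μ (κ * (k / κ)))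
    (hT : ∀ j, LinearMap.range (T s).Tuo.mulVecLin = G.unobservable s j)
    (hz : NormBounded fun k => G.residue T μ y k s - G.residue T μ y' k s) :
    NormBounded fun i => (fun t : Fin κ => y (κ * i + t) s - y' (κ * i + t) s)
      - (Matrix.of fun t : Fin κ => G.localC T s (μ (κ * i)) ᵥ* G.localA T s (μ (κ * i)) ^ (t : ℕ))
        *ᵥ G.priorDiff T μ y y' s (κ * i) := by
  refine .pi fun t => ?_
  have h1 := (G.innovDiff_bounded hκ hκ0 hμ hT hz).comp fun i => κ * i + t
  have hc : NormBounded fun i => G.localC T s (μ (κ * i)) := .of_finite _ fun i => μ (κ * i)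
  have h2 := hc.dotProduct
    (G.priorDiff_block_bounded hμ (G.correctionDiff_bounded hκ hκ0 hμ hT hz) t.2)
  convert h1.add h2 using 2 with i
  · rfl
  rw [dotProduct_sub, dotProduct_mulVec _ (_ ^ _)]
  simp only [Pi.sub_apply, mulVec, of_apply, innovDiff, mode_add hμ t.2]
  ring

theorem localObs_eq_obsMatrix
    (hT : ∀ j, LinearMap.range (T s).Tuo.mulVecLin = G.unobservable s j) (j : Fin l)
    (ζ : Fin (T s).r → ℝ) :
    (Matrix.of fun t : Fin κ => G.localC T s j ᵥ* G.localA T s j ^ (t : ℕ)) *ᵥ ζ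
      = G.obsMatrix s κ j *ᵥ ((T s).To *ᵥ ζ) := by
  ext t
  rw [obsMatrix_mulVec, ← G.localC_vecMul_pow_Vo T (hT j), ← dotProduct_mulVec,
    mulVec_mulVec, (T s).Vo_mul_To, one_mulVec]
  rfl

/-- Bounded measurement differences bound the local outputs over a block; injectivity of the
observability map then bounds the estimate difference at the block start, and from there in the
whole block. -/
theorem postDiff_bounded (hκ : n ≤ κ) (hκ0 : 0 < κ) (hμ : ∀ k, μ k = μ (κ * (k / κ)))
    (hT : ∀ j, LinearMap.range (T s).Tuo.mulVecLin = G.unobservable s j)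
    (hz : NormBounded fun k => G.residue T μ y k s - G.residue T μ y' k s)
    (hy : NormBounded fun k => y k s - y' k s) :
    NormBounded fun k => G.postEst T μ y k s - G.postEst T μ y' k s := by
  have hu := G.correctionDiff_bounded hκ hκ0 hμ hT hz
  have hstart : NormBounded fun i => G.priorDiff T μ y y' s (κ * i) := by
    have h1 : NormBounded fun i (t : Fin κ) => y (κ * i + t) s - y' (κ * i + t) s :=
      .pi fun t => hy.comp fun i => κ * i + t
    have h2 := h1.sub (G.measDiff_sub_localObs_bounded hκ hκ0 hμ hT hz)
    simp only [sub_sub_cancel] at h2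
    exact NormBounded.of_injective_image (fun j => (Matrix.of fun t : Fin κ =>
      G.localC T s j ᵥ* G.localA T s j ^ (t : ℕ)).mulVecLin)
      (fun j => G.local_obs_injective T hκ (hT j)) (fun i => μ (κ * i)) h2
  have hpow (t : ℕ) :
      NormBounded fun i => G.localA T s (μ (κ * i)) ^ t *ᵥ G.priorDiff T μ y y' s (κ * i) :=
    .mulVec (fun a b => .of_finite (fun j => (G.localA T s j ^ t) a b) fun i => μ (κ * i)) hstart
  have hall : NormBounded (G.priorDiff T μ y y' s) := by
    refine NormBounded.of_finite_fibers (fun k => (⟨k % κ, Nat.mod_lt k hκ0⟩ : Fin κ)) fun t => ?_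
    have h1 := (G.priorDiff_block_bounded hμ hu t.2).add (hpow t)
    simp only [sub_add_cancel] at h1
    obtain ⟨B, hB⟩ := h1
    refine ⟨B, fun k hk => ?_⟩
    have hk' : k % κ = t := Fin.ext_iff.mp hk
    have : ‖G.priorDiff T μ y y' s (κ * (k / κ) + t)‖ ≤ B := hB (k / κ)
    rwa [← hk', Nat.div_add_mod] at this
  simpa only [postEst_sub_postEst] using hall.add hu

/-! ### Fusion -/

theorem fusionW_mulVec (θ : (Σ s : Fin m, Fin (T s).u) ⊕ Fin n → ℝ) (s : Fin m) (i : Fin n) :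
    (fusionW T *ᵥ θ) (s, i)
      = θ (Sum.inr i) - ((T s).Tuo *ᵥ fun b => θ (Sum.inl ⟨s, b⟩)) i := by
  rw [mulVec, dotProduct, Fintype.sum_sum_type, Fintype.sum_sigma, Finset.sum_eq_single s]
  · simp [fusionW, mulVec, dotProduct]
    ring
  · intro b _ hb
    refine Finset.sum_eq_zero fun k _ => ?_
    simp [fusionW, hb.symm]
  · simp

/-- For a kernel element, the last `n` entries lie in the unobservable space of every sensor, so
joint observability makes them 0; the other entries vanish because `Vuo` is a left inverse of `Tuo`.
-/
theorem fusionW_injective (hobs : ∀ j, IsObservablePair (G.A j) (G.C j)) (j : Fin l)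
    (hT : ∀ s j, LinearMap.range (T s).Tuo.mulVecLin = G.unobservable s j) :
    LinearMap.ker (fusionW T).mulVecLin = ⊥ := by
  rw [LinearMap.ker_eq_bot']
  intro θ hθ
  have h (s : Fin m) : (fun i => θ (Sum.inr i)) = (T s).Tuo *ᵥ fun b => θ (Sum.inl ⟨s, b⟩) := by
    ext i
    have := congrFun hθ (s, i)
    rw [mulVecLin_apply, fusionW_mulVec] at this
    exact sub_eq_zero.mp this
  have hx : (fun i => θ (Sum.inr i)) = 0 := by
    refine hobs j _ fun k hk => ?_
    ext s
    have hs : (fun i => θ (Sum.inr i)) ∈ G.unobservable s j := by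
      rw [← hT s j, h s]
      exact ⟨_, rfl⟩
    have := G.mem_unobservable.mp hs k hk
    exact this
  ext c
  rcases c with ⟨s, b⟩ | i
  · have h1 := h s
    rw [hx] at h1
    have h2 := congrArg (fun x => (T s).Vuo *ᵥ x) h1
    simp only [mulVec_zero, mulVec_mulVec, (T s).Vuo_mul_Tuo, one_mulVec] at h2
    exact (congrFun h2 b).symm
  · exact congrFun hx i

theorem _root_.Matrix.dotProduct_self_le {ι : Type*} [Fintype ι] {Υ : Matrix ι ι ℝ} {σ : ℝ}
    [DecidableEq ι] (hΥ : (Υ - σ • (1 : Matrix ι ι ℝ)).PosSemidef) (p : ι → ℝ) :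
    σ * (p ⬝ᵥ p) ≤ p ⬝ᵥ (Υ *ᵥ p) := by
  have := hΥ.dotProduct_mulVec_nonneg p
  rw [star_trivial, sub_mulVec, smul_mulVec, one_mulVec, dotProduct_sub, dotProduct_smul,
    smul_eq_mul] at this
  linarith

/-- Weighted least squares estimates of bounded data with a bounded covariance that is uniformly
positive definite are bounded. -/
theorem _root_.NormBounded.weighted_least_squares {K ι ι' : Type*} [Fintype ι] [Fintype ι']
    [DecidableEq ι] [DecidableEq ι'] {W : Matrix ι ι' ℝ} (hW : LinearMap.ker W.mulVecLin = ⊥)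
    {σ : ℝ} (hσ : 0 < σ) {Υ : K → Matrix ι ι ℝ}
    (hΥ : ∀ k, (Υ k - σ • (1 : Matrix ι ι ℝ)).PosSemidef)
    (hΥb : ∀ i i', NormBounded fun k => Υ k i i') {y : K → ι → ℝ} (hy : NormBounded y) :
    NormBounded fun k => ((Wᵀ * (Υ k)⁻¹ * W)⁻¹ * Wᵀ * (Υ k)⁻¹) *ᵥ y k := by
  have hpd (k : K) : (Υ k).PosDef := by
    have h1 : (σ • (1 : Matrix ι ι ℝ)).PosDef := PosDef.one.smul hσ
    simpa using h1.add_posSemidef (hΥ k)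
  have hN (k : K) : (Wᵀ * (Υ k)⁻¹ * W).PosDef := by
    have := (hpd k).inv.conjTranspose_mul_mul_same (B := W) (by
      exact LinearMap.ker_eq_bot.mp hW)
    rwa [conjTranspose_eq_transpose_of_trivial] at this
  set θ : K → ι' → ℝ := fun k => ((Wᵀ * (Υ k)⁻¹ * W)⁻¹ * Wᵀ * (Υ k)⁻¹) *ᵥ y k with hθ
  -- Bounding `p` avoids estimates of inverse matrices: the normal equations give `p ⬝ᵥ Υ p = p ⬝ᵥ
  -- y`, so `Υ ≥ σ I` bounds `p` by `y / σ`, and `W θ = Υ p` is bounded.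
  set p : K → ι → ℝ := fun k => (Υ k)⁻¹ *ᵥ (W *ᵥ θ k) with hp
  have hΥp (k : K) : Υ k *ᵥ p k = W *ᵥ θ k := by
    rw [hp, mulVec_mulVec, mul_nonsing_inv _ ((isUnit_iff_isUnit_det _).mp (hpd k).isUnit),
      one_mulVec]
  have hnormal (k : K) : Wᵀ *ᵥ p k = Wᵀ *ᵥ ((Υ k)⁻¹ *ᵥ y k) := by
    have hu := (isUnit_iff_isUnit_det _).mp (hN k).isUnit
    simp only [hp, hθ, mulVec_mulVec]
    rw [Matrix.mul_assoc _ Wᵀ, ← Matrix.mul_assoc Wᵀ, ← Matrix.mul_assoc (Wᵀ * _),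
      ← Matrix.mul_assoc (Wᵀ * _ * W), mul_nonsing_inv _ hu, Matrix.one_mul]
  have hpy (k : K) : p k ⬝ᵥ (Υ k *ᵥ p k) = p k ⬝ᵥ y k := by
    have hsymm : ((Υ k)⁻¹)ᵀ = (Υ k)⁻¹ := by simpa using (hpd k).inv.isHermitian.eq
    calc p k ⬝ᵥ (Υ k *ᵥ p k) = (Wᵀ *ᵥ p k) ⬝ᵥ θ k := by
          rw [hΥp, dotProduct_mulVec, mulVec_transpose]
      _ = ((Υ k)⁻¹ *ᵥ y k) ⬝ᵥ (W *ᵥ θ k) := by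
          rw [hnormal, mulVec_transpose, ← dotProduct_mulVec]
      _ = p k ⬝ᵥ y k := by
          rw [show p k = (Υ k)⁻¹ *ᵥ (W *ᵥ θ k) from rfl, dotProduct_comm ((Υ k)⁻¹ *ᵥ (W *ᵥ θ k)),
            dotProduct_mulVec (y k), ← mulVec_transpose, hsymm]
  have hpb : NormBounded p := by
    obtain ⟨B, hB⟩ := hy.dotProduct hy
    -- The maximum with 1 replaces a square root: a number above 1 is at most its square.
    refine .pi fun i => ⟨max 1 (B / σ ^ 2), fun k => ?_⟩
    have h1 := Matrix.dotProduct_self_le (hΥ k) (p k)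
    rw [hpy] at h1
    have h2 : y k ⬝ᵥ y k ≤ B := (Real.le_norm_self _).trans (hB k)
    have h3 : 0 ≤ (σ • p k - y k) ⬝ᵥ (σ • p k - y k) := by
      simpa using dotProduct_star_self_nonneg (σ • p k - y k)
    simp only [sub_dotProduct, dotProduct_sub, smul_dotProduct, dotProduct_smul, smul_eq_mul,
      dotProduct_comm (y k) (p k)] at h3
    have h4 : σ ^ 2 * (p k ⬝ᵥ p k) ≤ B := by
      have := mul_le_mul_of_nonneg_left h1 hσ.le
      nlinarith
    have h5 : p k i * p k i ≤ p k ⬝ᵥ p k :=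
      Finset.single_le_sum (f := fun i => p k i * p k i) (fun i _ => mul_self_nonneg _)
        (Finset.mem_univ i)
    have h6 : ‖p k i‖ ^ 2 ≤ B / σ ^ 2 := by
      rw [Real.norm_eq_abs, sq_abs, le_div_iff₀ (by positivity)]
      nlinarith [sq_nonneg σ]
    by_cases h7 : ‖p k i‖ ≤ 1
    · exact h7.trans (le_max_left _ _)
    · exact le_trans (by nlinarith) (h6.trans (le_max_right _ _))
  have hWθ : NormBounded fun k => W *ᵥ θ k := by
    simpa only [hΥp] using NormBounded.mulVec hΥb hpb
  exact NormBounded.of_injective_image (fun _ : Unit => W.mulVecLin) (fun _ => hW)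
    (fun _ => ()) hWθ

theorem posSemidef_fusionCov_sub (σ : ℝ) (k : ℕ) :
    (G.fusionCov T σ μ k - σ • (1 : Matrix (Fin m × Fin n) (Fin m × Fin n) ℝ)).PosSemidef := by
  have h := ((G.posSemidef_ofBlocks_postCov T μ k).ofBlocks_conj fun s => (T s).To).submatrix
    fun p : Fin m × Fin n => (⟨p.1, p.2⟩ : Σ _ : Fin m, Fin n)
  convert h using 1
  ext p p'
  simp [fusionCov, ofBlocks_apply, Matrix.one_apply]

theorem fusionCov_bounded (hκ : n ≤ κ) (hκ0 : 0 < κ) (hμ : ∀ k, μ k = μ (κ * (k / κ)))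
    (hT : ∀ s j, LinearMap.range (T s).Tuo.mulVecLin = G.unobservable s j) (σ : ℝ)
    (p p' : Fin m × Fin n) : NormBounded fun k => G.fusionCov T σ μ k p p' := by
  simp only [fusionCov, of_apply, Matrix.mul_apply]
  exact (NormBounded.sum _ fun _ _ => (NormBounded.sum _ fun _ _ => (NormBounded.const _).mul
    (G.postCov_bounded hκ hκ0 hμ hT _ _ _ _)).mul (.const _)).add (.const _)

theorem fusedEst_sub_bounded (hκ : n ≤ κ) (hκ0 : 0 < κ) (hμ : ∀ k, μ k = μ (κ * (k / κ)))
    (hobs : ∀ j, IsObservablePair (G.A j) (G.C j))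
    (hT : ∀ s j, LinearMap.range (T s).Tuo.mulVecLin = G.unobservable s j) {σ : ℝ} (hσ : 0 < σ)
    (α : ℕ → Fin m → Fin n → ℝ)
    (hpost : ∀ s, NormBounded fun k => G.postEst T μ y k s - G.postEst T μ y' k s) :
    NormBounded fun k => G.fusedEst T σ μ y α k - G.fusedEst T σ μ y' α k := by
  -- The artificial noise is the same in both runs and cancels.
  have hobsb : NormBounded fun k => G.fusionObs T μ y α k - G.fusionObs T μ y' α k := by
    refine .pi fun p => ?_
    have h := (NormBounded.mulVec (M := fun _ : ℕ => (T p.1).To) (fun _ _ => .const _)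
      (hpost p.1)).apply p.2
    convert h using 2 with k
    simp [fusionObs, mulVec_sub]
  have h := NormBounded.weighted_least_squares (G.fusionW_injective hobs (μ 0) hT) hσ
    (G.posSemidef_fusionCov_sub (T := T) (μ := μ) σ) (G.fusionCov_bounded hκ hκ0 hμ hT σ) hobsb
  refine .pi fun i => ?_
  have hi := h.apply (Sum.inr i)
  simp only [mulVec_sub] at hi
  exact hi

end HybridSystem

/-! ### Attacks that do not know the mode sequence -/

theorem NormBounded.limsup_enorm_ne_top {E : Type*} [SeminormedAddCommGroup E] {f : ℕ → E}
    (hf : NormBounded f) : limsup (fun k => ‖f k‖ₑ) atTop ≠ ⊤ := by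
  obtain ⟨B, hB⟩ := hf
  refine ne_top_of_le_ne_top (ENNReal.ofReal_ne_top (r := B)) ?_
  refine limsup_le_of_le (by isBoundedDefault) (Eventually.of_forall fun k => ?_)
  rw [← ofReal_norm]
  exact ENNReal.ofReal_le_ofReal (hB k)

theorem NormBounded.of_limsup_enorm_ne_top {E : Type*} [SeminormedAddCommGroup E] {f : ℕ → E}
    (hf : limsup (fun k => ‖f k‖ₑ) atTop ≠ ⊤) : NormBounded f := by
  obtain ⟨C, hC, -⟩ := ENNReal.lt_iff_exists_nnreal_btwn.mp (lt_top_iff_ne_top.mpr hf)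
  have h1 : ∀ᶠ k in atTop, ‖f k‖ ≤ C := by
    filter_upwards [eventually_lt_of_limsup_lt hC] with k hk
    rw [← ofReal_norm, ← ENNReal.ofReal_coe_nnreal] at hk
    exact (ENNReal.ofReal_lt_ofReal_iff_of_nonneg (norm_nonneg _)).mp hk |>.le
  have h2 : IsBoundedUnder (· ≤ ·) atTop fun k => ‖f k‖ := ⟨C, by simpa using h1⟩
  obtain ⟨B, hB⟩ := h2.bddAbove_range
  exact ⟨B, fun k => hB ⟨k, rfl⟩⟩

theorem normBounded_iff_exists_nat {ι : Type*} {f : ι → ℝ} :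
    NormBounded f ↔ ∃ N : ℕ, ∀ k, |f k| ≤ N :=
  ⟨fun ⟨B, hB⟩ => ⟨⌈B⌉₊, fun k => (hB k).trans (Nat.le_ceil B)⟩, fun ⟨N, hN⟩ => ⟨N, hN⟩⟩

namespace HybridSystem

open Matrix

variable {n m l : ℕ} (G : HybridSystem n m l) {κ : ℕ}

/-- The attack `a` is compatible up to `M` with the outputs of the mode sequence `μ` at sensor
`s`. -/
def NearOutputs (κ : ℕ) (s : Fin m) (M : ℝ) (a : ℕ → ℝ) (μ : ℕ → Fin l) : Prop :=
  ∀ i, Metric.infDist (fun t : Fin κ => a (κ * i + t))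
    (LinearMap.range (G.obsMatrix s κ (μ (κ * i))).mulVecLin : Set (Fin κ → ℝ)) ≤ M

/-- An unbounded attack that is compatible with the outputs reveals the modes at infinitely many
times. -/
theorem exists_guess [Nonempty (Fin l)] (hκ : 2 * n ≤ κ) (hκ0 : 0 < κ)
    (hA : ∀ i j : Fin l, i ≠ j → Disjoint (eigenvalueSet (G.A i)) (eigenvalueSet (G.A j)))
    (s : Fin m) (M : ℝ) {a : ℕ → ℝ} (ha : ¬ NormBounded a) :
    ∃ (g : ℕ → Fin l) (ρ : ℕ → ℕ), StrictMono ρ ∧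
      ∀ μ : ℕ → Fin l, G.NearOutputs κ s M a μ → ∀ k, μ (ρ k) = g k := by
  classical
  set b : ℕ → Fin κ → ℝ := fun i t => a (κ * i + t) with hb
  set U : Fin l → Submodule ℝ (Fin κ → ℝ) :=
    fun j => LinearMap.range (G.obsMatrix s κ j).mulVecLin with hU
  -- The slack in `M + 1` allows choosing points of the subspaces without attaining the infimum
  -- distance.
  have hbound (c : Fin l × Fin l) : ∃ B : ℝ, c.1 ≠ c.2 → ∀ x : Fin κ → ℝ,
      ∀ u ∈ U c.1, ∀ v ∈ U c.2, ‖x - u‖ ≤ M + 1 → ‖x - v‖ ≤ M + 1 → ‖x‖ ≤ B := by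
    by_cases hc : c.1 = c.2
    · exact ⟨0, fun h => (h hc).elim⟩
    · obtain ⟨B, hB⟩ :=
        Submodule.exists_bound_of_disjoint (G.obs_disjoint hκ s (hA _ _ hc)) (M + 1)
      exact ⟨B, fun _ => hB⟩
  choose B hB using hbound
  obtain ⟨B₀, hB₀⟩ := (Set.finite_range B).bddAbove
  have hI : {i | B₀ < ‖b i‖}.Infinite := by
    intro hfin
    obtain ⟨C, hC⟩ := (hfin.image fun i => ‖b i‖).bddAbove
    refine ha ⟨max B₀ C, fun k => ?_⟩
    have h1 : ‖a k‖ ≤ ‖b (k / κ)‖ := by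
      have := norm_le_pi_norm (b (k / κ)) ⟨k % κ, Nat.mod_lt k hκ0⟩
      simpa only [hb, Nat.div_add_mod] using this
    refine h1.trans ?_
    by_cases h2 : B₀ < ‖b (k / κ)‖
    · exact le_max_of_le_right (hC ⟨_, h2, rfl⟩)
    · exact le_max_of_le_left (not_lt.mp h2)
  -- The guess is any mode that fits the `k`th large block, chosen from the attack alone; it is
  -- correct because a large block fits at most one mode.
  refine ⟨fun k => Classical.epsilon fun j =>
      Metric.infDist (b (Nat.nth (fun i => B₀ < ‖b i‖) k)) (U j : Set (Fin κ → ℝ)) ≤ M,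
    fun k => κ * Nat.nth (fun i => B₀ < ‖b i‖) k,
    fun k k' h => Nat.mul_lt_mul_of_pos_left (Nat.nth_strictMono hI h) hκ0,
    fun μ hμ k => ?_⟩
  set i := Nat.nth (fun i => B₀ < ‖b i‖) k with hi
  have hbi : B₀ < ‖b i‖ := Nat.nth_mem_of_infinite hI k
  have h1 := hμ i
  have h2 := Classical.epsilon_spec
    (p := fun j => Metric.infDist (b i) (U j : Set (Fin κ → ℝ)) ≤ M) ⟨_, h1⟩
  set j := Classical.epsilon fun j => Metric.infDist (b i) (U j : Set (Fin κ → ℝ)) ≤ M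
  by_contra hne
  have near {j : Fin l} (h : Metric.infDist (b i) (U j : Set (Fin κ → ℝ)) ≤ M) :
      ∃ u ∈ U j, ‖b i - u‖ ≤ M + 1 := by
    obtain ⟨u, hu, hlt⟩ := (Metric.infDist_lt_iff (U j).nonempty).mp
      (h.trans_lt (lt_add_one M))
    exact ⟨u, hu, (dist_eq_norm (b i) u ▸ hlt).le⟩
  obtain ⟨u, hu, hub⟩ := near h1
  obtain ⟨v, hv, hvb⟩ := near h2
  exact absurd ((hB (μ (κ * i), j) hne _ u hu v hv hub hvb).trans (hB₀ ⟨_, rfl⟩)) (not_le.mpr hbi)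

theorem measurableSet_unbounded_nearOutputs {Δ : Type*} [MeasurableSpace Δ] (s : Fin m) (M : ℝ)
    {f : ℕ → Δ → ℝ} (hf : ∀ k, Measurable (f k)) :
    MeasurableSet {p : Δ × (ℕ → Fin l) | ¬ NormBounded (fun k => f k p.1) ∧
      G.NearOutputs κ s M (fun k => f k p.1) p.2} := by
  have h1 : MeasurableSet {p : Δ × (ℕ → Fin l) | NormBounded (fun k => f k p.1)} := by
    simp only [normBounded_iff_exists_nat, Set.ofPred_exists, Set.ofPred_forall]
    refine .iUnion fun N => .iInter fun k => ?_
    exact measurableSet_le (((hf k).comp measurable_fst).abs) measurable_const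
  refine h1.compl.inter ?_
  -- Splitting over the finitely many values of the mode leaves distances to fixed subspaces, which
  -- are measurable.
  have e : {p : Δ × (ℕ → Fin l) | G.NearOutputs κ s M (fun k => f k p.1) p.2}
      = ⋂ i, ⋂ j : Fin l, {p | p.2 (κ * i) = j}ᶜ ∪
        {p | Metric.infDist (fun t : Fin κ => f (κ * i + t) p.1)
          (LinearMap.range (G.obsMatrix s κ j).mulVecLin : Set (Fin κ → ℝ)) ≤ M} := by
    ext p
    simp only [NearOutputs, Set.mem_ofPred_eq, Set.mem_iInter, Set.mem_union, Set.mem_compl_iff]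
    exact forall_congr' fun i => ⟨fun h j => or_iff_not_imp_left.mpr fun hj => by
      rw [not_not] at hj; rw [← hj]; exact h, fun h => (h _).resolve_left (not_not.mpr rfl)⟩
  have h2 : MeasurableSet {p : Δ × (ℕ → Fin l) | G.NearOutputs κ s M (fun k => f k p.1) p.2} := by
    rw [e]
    refine .iInter fun i => .iInter fun j => .union (MeasurableSet.compl ?_) ?_
    · exact measurableSet_eq_fun ((measurable_pi_apply (κ * i)).comp measurable_snd)
        measurable_const
    · refine measurableSet_le (Measurable.infDist ?_) measurable_const
      exact measurable_pi_lambda _ fun t => (hf _).comp measurable_fst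
  exact h2

variable {Ω : Type*} [MeasurableSpace Ω]

/-- Almost surely, an attack that is independent of the modes and unbounded at the sensor `s` is not
compatible with the outputs of `s`. -/
theorem ae_bounded_of_nearOutputs {Pr : Measure Ω} [IsProbabilityMeasure Pr]
    {mode : ℕ → Ω → Fin l} (hmode : ∀ k, Measurable (mode k))
    (hdesign : G.DesignRecommendations Pr mode κ) (hκ0 : 0 < κ) {Δ : Type*} [MeasurableSpace Δ]
    {d : Ω → Δ} (hd : Measurable d) (hindep : IndepFun d (fun ω k => mode k ω) Pr)
    {f : ℕ → Δ → ℝ} (hf : ∀ k, Measurable (f k)) (s : Fin m) (M : ℝ) :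
    ∀ᵐ ω ∂Pr, G.NearOutputs κ s M (fun k => f k (d ω)) (fun k => mode k ω) →
      NormBounded fun k => f k (d ω) := by
  have : Nonempty (Fin l) := by
    obtain ⟨ω⟩ := nonempty_of_isProbabilityMeasure Pr
    exact ⟨mode 0 ω⟩
  have hmode' : Measurable fun ω k => mode k ω := measurable_pi_lambda _ hmode
  have hmap := (indepFun_iff_map_prod_eq_prod_map_map hd.aemeasurable hmode'.aemeasurable).mp hindep
  have hmeas := G.measurableSet_unbounded_nearOutputs (κ := κ) s M hf
  have : IsProbabilityMeasure (Pr.map fun ω k => mode k ω) :=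
    Measure.isProbabilityMeasure_map hmode'.aemeasurable
  have hnull : Pr.map (fun ω => (d ω, fun k => mode k ω))
      {p | ¬ NormBounded (fun k => f k p.1) ∧ G.NearOutputs κ s M (fun k => f k p.1) p.2} = 0 := by
    -- Independence makes the joint law a product, so it suffices that each section at a fixed
    -- attack `δ` is null.
    rw [hmap, Measure.measure_prod_null hmeas]
    refine Eventually.of_forall fun δ => ?_
    rw [Pi.zero_apply]
    beta_reduce
    rw [Measure.map_apply hmode' (measurable_prodMk_left hmeas)]
    by_cases hδ : NormBounded fun k => f k δ
    · convert measure_empty (μ := Pr)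
      ext ω
      simp [hδ]
    · obtain ⟨g, ρ, hρ, hg⟩ :=
        G.exists_guess hdesign.two_mul_le hκ0 hdesign.disjoint_eigenvalues s M hδ
      refine measure_mono_null ?_ (hdesign.unguessable g ρ hρ)
      intro ω hω
      have hω' : G.NearOutputs κ s M (fun k => f k δ) (fun k => mode k ω) := hω.2
      simp only [Set.mem_ofPred_eq]
      exact fun k => by rw [hg _ hω' k]
  rw [Measure.map_apply (hd.prodMk hmode') hmeas] at hnull
  filter_upwards [measure_eq_zero_iff_ae_notMem.mp hnull] with ω hω h
  by_contra hb
  exact hω ⟨hb, h⟩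

theorem measurement_sub (μ : ℕ → Fin l) (x0 : Fin n → ℝ) (w : ℕ → Fin n → ℝ) (v : ℕ → Fin m → ℝ)
    (a : ℕ → Fin m → ℝ) (k : ℕ) (s : Fin m) :
    G.measurement μ x0 w v a k s - G.measurement μ x0 w v 0 k s = a k s := by
  simp only [measurement, Pi.add_apply, Pi.zero_apply]
  ring

/-- A bounded residue bias makes the attack compatible with the outputs. -/
theorem exists_nearOutputs {T : Fin m → SensorTransform n} {μ : ℕ → Fin l} (hκ : n ≤ κ)
    (hκ0 : 0 < κ) (hμ : ∀ k, μ k = μ (κ * (k / κ))) {s : Fin m}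
    (hT : ∀ j, LinearMap.range (T s).Tuo.mulVecLin = G.unobservable s j)
    {y y' : ℕ → Fin m → ℝ}
    (hz : NormBounded fun k => G.residue T μ y k s - G.residue T μ y' k s) :
    ∃ M : ℕ, G.NearOutputs κ s M (fun k => y k s - y' k s) μ := by
  obtain ⟨B, hB⟩ := G.measDiff_sub_localObs_bounded hκ hκ0 hμ hT hz
  refine ⟨⌈B⌉₊, fun i => ?_⟩
  have h := hB i
  beta_reduce at h
  rw [G.localObs_eq_obsMatrix hT, ← dist_eq_norm] at h
  exact (Metric.infDist_le_dist_of_mem (LinearMap.mem_range_self _ _)).trans (h.trans (Nat.le_ceil B))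

/-- The attack does not act on the plant state, so the error bias is minus the bias of the estimate;
the change from sup norm to Euclidean norm is harmless. -/
theorem fusedErrorBias_bounded {T : Fin m → SensorTransform n} {μ : ℕ → Fin l} {σ : ℝ}
    {x0 : Fin n → ℝ} {w : ℕ → Fin n → ℝ} {v : ℕ → Fin m → ℝ} {α : ℕ → Fin m → Fin n → ℝ}
    {a : ℕ → Fin m → ℝ}
    (h : NormBounded fun k => G.fusedEst T σ μ (G.measurement μ x0 w v a) α k
      - G.fusedEst T σ μ (G.measurement μ x0 w v 0) α k) :
    NormBounded (G.fusedErrorBias T σ μ x0 w v α a) := by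
  refine NormBounded.of_injective_image
    (fun _ : Unit => (WithLp.linearEquiv 2 ℝ (Fin n → ℝ)).toLinearMap)
    (fun _ => LinearEquiv.ker _) (fun _ => ()) ?_
  convert h.neg using 2 with k
  · rfl
  exact (sub_sub_sub_cancel_left _ _ _).trans (neg_sub _ _).symm

end HybridSystem

end

theorem theorem5 {n m l q : ℕ} (G : HybridSystem n m l)
    {Ω : Type*} [MeasurableSpace Ω] (Pr : Measure Ω) [IsProbabilityMeasure Pr]
    -- the random mode sequence follows the design recommendations
    (mode : ℕ → Ω → Fin l) (hmode : ∀ k, Measurable (mode k))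
    (κ : ℕ) (hdesign : G.DesignRecommendations Pr mode κ)
    -- initial state, process noise, sensor noise, artificial noise
    (σ : ℝ) (hσ : 0 < σ)
    (x0 : Ω → EuclideanSpace ℝ (Fin n)) (w : ℕ → Ω → EuclideanSpace ℝ (Fin n))
    (v : ℕ → Ω → EuclideanSpace ℝ (Fin m)) (α : ℕ → Fin m → Ω → EuclideanSpace ℝ (Fin n))
    (hnoise : G.NoiseModel Pr σ mode x0 w v α)
    -- for each sensor all modes have the same unobservable subspace, spanned by the columns of Tuo
    (hNS : ∀ (s : Fin m) (i j : Fin l), G.unobservable s i = G.unobservable s j)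
    (T : Fin m → SensorTransform n)
    (hT : ∀ (s : Fin m) (j : Fin l), LinearMap.range (T s).Tuo.mulVecLin = G.unobservable s j)
    -- the attack on the sensors in L, chosen without knowledge of the mode sequence
    (L : Fin q ↪ Fin m) (d : ℕ → Ω → Fin q → ℝ) (hd : ∀ k, Measurable (d k))
    (hindep : IndepFun (fun ω k => d k ω) (fun ω k => mode k ω) Pr) :
    ∀ᵐ ω ∂Pr,
      limsup (fun k => ‖G.fusedErrorBias T σ (fun k => mode k ω) (x0 ω).ofLp
          (fun k => (w k ω).ofLp) (fun k => (v k ω).ofLp) (fun k s => (α k s ω).ofLp)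
          (fun k => attackMatrix L *ᵥ d k ω) k‖ₑ) atTop = ⊤ →
      ∃ i : Fin m,
        limsup (fun k => ‖G.residueBias T (fun k => mode k ω) (x0 ω).ofLp
          (fun k => (w k ω).ofLp) (fun k => (v k ω).ofLp)
          (fun k => attackMatrix L *ᵥ d k ω) k i‖ₑ) atTop = ⊤ := by
  -- The distance `M` depends on `ω`; taking it in `ℕ` leaves only countably many null sets to
  -- discard.
  have hae : ∀ᵐ ω ∂Pr, ∀ (s : Fin m) (M : ℕ), 0 < κ →
      G.NearOutputs κ s M (fun k => (attackMatrix L *ᵥ d k ω) s) (fun k => mode k ω) →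
        NormBounded fun k => (attackMatrix L *ᵥ d k ω) s := by
    rw [ae_all_iff]
    intro s
    rw [ae_all_iff]
    intro M
    by_cases hκ0 : 0 < κ
    · have hf (k : ℕ) : Measurable fun δ : ℕ → Fin q → ℝ => (attackMatrix L *ᵥ δ k) s := by
        simp only [Matrix.mulVec, dotProduct]
        fun_prop
      filter_upwards [G.ae_bounded_of_nearOutputs hmode hdesign hκ0
        (measurable_pi_lambda _ hd) hindep hf s M] with ω hω _
      exact hω
    · exact Eventually.of_forall fun ω h => (hκ0 h).elim
  filter_upwards [hae] with ω hω
  contrapose!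
  intro hz
  refine NormBounded.limsup_enorm_ne_top ?_
  -- For `n = 0` the block length may be 0, but then the error lives in a trivial space.
  rcases Nat.eq_zero_or_pos n with rfl | hn
  · exact ⟨0, fun k => by rw [Subsingleton.elim (G.fusedErrorBias _ _ _ _ _ _ _ _ k) 0, norm_zero]⟩
  have hκ : n ≤ κ := by have := hdesign.two_mul_le; omega
  have hκ0 : 0 < κ := hn.trans_le hκ
  have hμ (k : ℕ) : mode k ω = mode (κ * (k / κ)) ω := hdesign.mode_const k ω
  have hz' (s : Fin m) := NormBounded.of_limsup_enorm_ne_top (hz s)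
  refine G.fusedErrorBias_bounded (G.fusedEst_sub_bounded hκ hκ0 hμ hdesign.observable hT hσ _
    fun s => G.postDiff_bounded hκ hκ0 hμ (hT s) (hz' s) ?_)
  obtain ⟨M, hM⟩ := G.exists_nearOutputs hκ hκ0 hμ (hT s) (hz' s)
  simp only [HybridSystem.measurement_sub] at hM ⊢
  exact hω s M hκ0 hM
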